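/- **Setting.** Fix a first-order signature $\Sigma$ and a set $V$ of variables. A state is $s=(\sigma,\mu)$ with $\sigma=(\mathcal U,\mathcal I)$ a $\Sigma$-structure with finite universe and $\mu:V\to\mathcal U$ an assignment; $\mu[\nu]$ is $\mu$ updated according to $\nu:X\to\mathcal U$. $\mathfrak S_X$ is the set of permutations of $X$, and $\phi\pi$ is the result of substituting the free variables of $\phi$ according to $\pi$. Sequences are written $\bar\phi=\langle\phi_1,\dots,\phi_{n}\rangle$, $n=|\bar\phi|$; $\epsilon$ is the empty sequence. *Bounded languages*, with their bottoms ($X\subseteq V$ finite, $k\in\mathbb N$): $\mathcal L_A=A\cup\{\bot\}$ for a finite $\mathfrak S_V$-closed set $A$ of first-order formulas, bottom $\bot$; $\mathcal L_1\circ\mathcal L_2=\{\phi_1\circ\phi_2\mid\phi_i\in\mathcal L_i\}$ for $\circ\in\{\vee,\wedge\}$, bottom $\bot_{\mathcal L_1}\circ\bot_{\mathcal L_2}$; $\bigvee_k\mathcal L=\{\bigvee\bar\phi\mid \bar\phi\in\mathcal L^*,|\bar\phi|\le k\}$, bottom $\bigvee\epsilon$; $\bigwedge_\omega\mathcal L=\{\bigwedge\bar\phi\mid\epsilon\ne\bar\phi\in\mathcal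 L^*\}$, bottom $\bigwedge\langle\bot_{\mathcal L}\rangle$; $\exists_X\mathcal L=\{\exists X.\phi\mid\phi\in\mathcal L\}$ and $\forall_X\mathcal L=\{\forall X.\phi\mid\phi\in\mathcal L\}$, bottoms $\exists X.\bot_{\mathcal L}$ and $\forall X.\bot_{\mathcal L}$; $\exists\forall_X\mathcal L=\exists_X\mathcal L\cup\forall_X\mathcal L$, bottom $\forall X.\bot_{\mathcal L}$. Satisfaction $s\models\phi$ is standard ($\bigvee\epsilon$ is false). Bound variables are assumed not to interfere: for a quantifier constructor over $X$ with body $\mathcal L$, following any path from $\mathcal L$ inwards, every quantified set $Y$ that is met is disjoint from $X$, until possibly one is met that contains $X$ (below it nothing is required for this $X$). So permutations in $\mathfrak S_X$ act on formulas of $\mathcal L$ without variable capture. *Subsumption* $\sqsubseteq_{\mathcal L}$: on $\mathcal L_A$, $\phi\sqsubseteq\psi$ iff $\phi=\bot$ or $\phi=\psi$; componentwise for $\mathcal L_1\circ\mathcal L_2$; $\bigvee\bar\phi\sqsubseteq\bigvee\bar\psi$ iff there is an injective map $m$ of indices with $\phi_i\sqsubseteq_{\mathcal L}\psi_{m(i)}$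 for all $i$; $\bigwedge\bar\phi\sqsubseteq\bigwedge\bar\psi$ iff there is a map $m$ of indices with $\phi_{m(i)}\sqsubseteq_{\mathcal L}\psi_i$ for all $i$; $QX.\phi\sqsubseteq QX.\psi$ in $Q_X\mathcal L$ ($Q\in\{\exists,\forall\}$) iff $\phi\sqsubseteq_{\mathcal L}\psi\pi$ for some $\pi\in\mathfrak S_X$; $QX.\phi\sqsubseteq Q'X.\psi$ in $\exists\forall_X\mathcal L$ iff the same holds and $Q=\forall$ or $Q'=\exists$. For a set $F$ of formulas, $\min_{\sqsubseteq}F=\{\phi\in F\mid\forall\psi\in F\setminus\{\phi\}.\ \psi\not\sqsubseteq\phi\}$. *Order* $\le_{\mathcal L}$ (strict part $<_{\mathcal L}$): on $\mathcal L_A$ an arbitrary total order extending $\sqsubseteq$; lexicographic on $\mathcal L_1\circ\mathcal L_2$; $\bigvee\bar\phi\le\bigvee\bar\psi$ iff $\bar\phi$ is a suffix of $\bar\psi$, or, at the rightmost position (counted from the end) where they differ, the entry of $\bar\phi$ is $<_{\mathcal L}$ that of $\bar\psi$; $\bigwedge\bar\phi\le\bigwedge\bar\psi$ iff $\bar\psi$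 is a prefix of $\bar\phi$, or, at the leftmost position where they differ, the entry of $\bar\phi$ is $<_{\mathcal L}$ that of $\bar\psi$; $QX.\phi\le QX.\psi$ iff $\phi\le_{\mathcal L}\psi$; in $\exists\forall_X\mathcal L$ moreover $\forall X.\phi\le\exists X.\psi$ always and never conversely. $\mathrm{sort}_{\le}$ denotes the sequence of the entries of a sequence (or of the elements of a finite set) in $\le_{\mathcal L}$-ascending order. *Canonicalization* $c_{\mathcal L}$: the identity on $\mathcal L_A$; componentwise on $\mathcal L_1\circ\mathcal L_2$; $c(\bigvee\bar\phi)=\bigvee\mathrm{sort}_{\le}\langle c_{\mathcal L}(\phi_1),\dots,c_{\mathcal L}(\phi_n)\rangle$; $c(\bigwedge\bar\phi)=\bigwedge\mathrm{sort}_{\le}\min_{\sqsubseteq}\{c_{\mathcal L}(\phi_1),\dots,c_{\mathcal L}(\phi_n)\}$; $c(QX.\phi)=QX.\min_{\le}\{c_{\mathcal L}(\phi\pi)\mid\pi\in\mathfrak S_X\}$ (in $Q_X\mathcal L$ and in $\exists\forall_X\mathcal L$). A formula $\phi\in\mathcal L$ is canonical if $c_{\mathcal L}(\phi)=\phi$.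 The *weaken operator* is, for $\phi\in\mathcal L$ canonical and $s$ a state, $$\mathcal W_{\mathcal L}(\phi,s)=\min{}_{\sqsubseteq_{\mathcal L}}\{c_{\mathcal L}(\psi)\mid\psi\in\mathcal L,\ \phi\sqsubseteq_{\mathcal L}\psi,\ s\models\psi\}.$$ **Theorem (Implementation of Weaken).** Let $\phi$ be a canonical formula of a bounded language $\mathcal L$ and $s=(\sigma,\mu)$ a state. If $s\models\phi$, then $\mathcal W_{\mathcal L}(\phi,s)=\{\phi\}$. If $s\not\models\phi$, then: 1. $\mathcal W_{\mathcal L_A}(\phi,s)=\{\psi\in A\mid s\models\psi\}$ if $\phi=\bot$, and $=\emptyset$ if $\phi\ne\bot$. 2. $\mathcal W_{\mathcal L_1\vee\mathcal L_2}(\phi_1\vee\phi_2,s)=\{\psi\vee\phi_2\mid\psi\in\mathcal W_{\mathcal L_1}(\phi_1,s)\}\cup\{\phi_1\vee\psi\mid\psi\in\mathcal W_{\mathcal L_2}(\phi_2,s)\}$. 3. $\mathcal W_{\mathcal L_1\wedge\mathcal L_2}(\phi_1\wedge\phi_2,s)=\{\psi_1\wedge\psi_2\mid\psi_1\in\mathcal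 W_{\mathcal L_1}(\phi_1,s),\ \psi_2\in\mathcal W_{\mathcal L_2}(\phi_2,s)\}$. 4. $\mathcal W_{\bigvee_k\mathcal L}(\bigvee\bar\phi,s)=\min_{\sqsubseteq}(W_n\cup W_{n+1})$ with $n=|\bar\phi|$, where $W_n=\{\bigvee\mathrm{sort}_{\le}\langle\phi_1,\dots,\phi_{i-1},\psi,\phi_{i+1},\dots,\phi_n\rangle\mid 1\le i\le n,\ \psi\in\mathcal W_{\mathcal L}(\phi_i,s)\}$ and $W_{n+1}=\{\bigvee\mathrm{sort}_{\le}\langle\phi_1,\dots,\phi_n,\psi\rangle\mid\psi\in\mathcal W_{\mathcal L}(\bot_{\mathcal L},s),\ n<k\}$. 5. Let $M=\mathcal W_{\mathcal L}(\phi_1,s)\cup\dots\cup\mathcal W_{\mathcal L}(\phi_n,s)$, which is a finite set. Then $\mathcal W_{\bigwedge_\omega\mathcal L}(\bigwedge\bar\phi,s)=\{\bigwedge\mathrm{sort}_{\le}\min_{\sqsubseteq}M\}$ if $M\ne\emptyset$, and $=\emptyset$ if $M=\emptyset$. 6. $\mathcal W_{\exists_X\mathcal L}(\exists X.\phi,s)=\min_{\sqsubseteq}\{c(\exists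 X.\psi)\mid\nu:X\to\mathcal U,\ \psi\in\mathcal W_{\mathcal L}(\phi,(\sigma,\mu[\nu]))\}$. 7. $\mathcal W_{\forall_X\mathcal L}(\forall X.\phi,s)=\min_{\sqsubseteq}\{c(\forall X.\psi)\mid\psi\in\Omega\}$, where, for any enumeration $s_1,\dots,s_N$ of the states $(\sigma,\mu[\nu])$ with $\nu:X\to\mathcal U$ (in any order, repetitions allowed), $\Omega$ is the set of all $\phi_N$ such that there are $\phi_0=\phi$, $\phi_1\in\mathcal W_{\mathcal L}(\phi_0,s_1)$, ..., $\phi_N\in\mathcal W_{\mathcal L}(\phi_{N-1},s_N)$. 8. $\mathcal W_{\exists\forall_X\mathcal L}(\exists X.\phi,s)=\mathcal W_{\exists_X\mathcal L}(\exists X.\phi,s)$. 9. $\mathcal W_{\exists\forall_X\mathcal L}(\forall X.\phi,s)=\min_{\sqsubseteq}\big(\mathcal W_{\exists_X\mathcal L}(\exists X.\phi,s)\cup\mathcal W_{\forall_X\mathcal L}(\forall X.\phi,s)\big)$. -/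

import Mathlib

universe u v w x

/-- The two quantifiers. -/
inductive Quant where
  | ex
  | all

/-- Formulas of bounded first-order languages over the signature `S` and the variables `V`, as syntax
trees over ordinary first-order formulas: `atom` is an ordinary first-order formula with free
variables in `V`; `bigOr` and `bigAnd` take finite sequences; `quant q X φ` quantifies at once over
all the variables in the finite set `X`. -/
inductive Fml (S : FirstOrder.Language.{u, v}) (V : Type w) where
  | atom (f : S.Formula V)
  | or (φ ψ : Fml S V)
  | and (φ ψ : Fml S V)
  | bigOr (l : List (Fml S V))
  | bigAnd (l : List (Fml S V))
  | quant (q : Quant) (X : Finset V) (φ : Fml S V)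

/-- A finite set `A` of first-order formulas, closed under permutations of the variables, with
a total order on `A ∪ {⊥}` that extends base subsumption (`φ = ⊥` or `φ = ψ`). -/
structure BaseLang (S : FirstOrder.Language.{u, v}) (V : Type w) where
  A : Set (S.Formula V)
  finite : A.Finite
  closed : ∀ π : Equiv.Perm V, ∀ f ∈ A, f.relabel π ∈ A
  le : S.Formula V → S.Formula V → Prop
  le_total : ∀ f ∈ insert ⊥ A, ∀ g ∈ insert ⊥ A, le f g ∨ le g f
  le_trans : ∀ f ∈ insert ⊥ A, ∀ g ∈ insert ⊥ A, ∀ h ∈ insert ⊥ A, le f g → le g h → le f h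
  le_antisymm : ∀ f ∈ insert ⊥ A, ∀ g ∈ insert ⊥ A, le f g → le g f → f = g
  le_extends : ∀ f ∈ insert ⊥ A, ∀ g ∈ insert ⊥ A, f = ⊥ ∨ f = g → le f g

/-- (Descriptions of) bounded first-order languages. `quant q X L` is the language of the formulas
`q X. φ` and `quantAny X L` is the one that has both quantifiers. -/
inductive BLang (S : FirstOrder.Language.{u, v}) (V : Type w) where
  | base (B : BaseLang S V)
  | or (L₁ L₂ : BLang S V)
  | and (L₁ L₂ : BLang S V)
  | bigOr (k : ℕ) (L : BLang S V)
  | bigAnd (L : BLang S V)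
  | quant (q : Quant) (X : Finset V) (L : BLang S V)
  | quantAny (X : Finset V) (L : BLang S V)

noncomputable section

variable {S : FirstOrder.Language.{u, v}} {V : Type w} {U : Type x}

/-- The permutations of `V` that move only elements of `X`, i.e. the permutations of `X`. -/
def permsOn (X : Finset V) : Set (Equiv.Perm V) := {π | ∀ a, a ∉ X → π a = a}

open scoped Classical in
/-- Substitution of the free variables according to `g`; bound variables are left alone. -/
def Fml.subst (g : V → V) : Fml S V → Fml S V
  | .atom f => .atom (f.relabel g)
  | .or φ ψ => .or (φ.subst g) (ψ.subst g)
  | .and φ ψ => .and (φ.subst g) (ψ.subst g)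
  | .bigOr l => .bigOr (l.map (fun φ => φ.subst g))
  | .bigAnd l => .bigAnd (l.map (fun φ => φ.subst g))
  | .quant q Y φ => .quant q Y (φ.subst (fun a => if a ∈ Y then a else g a))

open scoped Classical in
/-- The assignment `μ` updated according to `ν : X → U`. -/
def updateOn {X : Finset V} (μ : V → U) (ν : X → U) : V → U :=
  fun a => if h : a ∈ X then ν ⟨a, h⟩ else μ a

/-- Satisfaction of a formula in the state given by the structure `U` and the assignment `μ`. -/
def Fml.Sat [S.Structure U] : Fml S V → (V → U) → Prop
  | .atom f, μ => f.Realize μ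
  | .or φ ψ, μ => φ.Sat μ ∨ ψ.Sat μ
  | .and φ ψ, μ => φ.Sat μ ∧ ψ.Sat μ
  | .bigOr l, μ => ∃ φ, ∃ _ : φ ∈ l, φ.Sat μ
  | .bigAnd l, μ => ∀ φ, ∀ _ : φ ∈ l, φ.Sat μ
  | .quant .ex X φ, μ => ∃ ν : X → U, φ.Sat (updateOn μ ν)
  | .quant .all X φ, μ => ∀ ν : X → U, φ.Sat (updateOn μ ν)

namespace BLang

/-- The set of formulas of a bounded language. -/
def formulas : BLang S V → Set (Fml S V)
  | .base B => {φ | ∃ f ∈ insert ⊥ B.A, φ = .atom f}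
  | .or L₁ L₂ => {φ | ∃ φ₁ ∈ L₁.formulas, ∃ φ₂ ∈ L₂.formulas, φ = .or φ₁ φ₂}
  | .and L₁ L₂ => {φ | ∃ φ₁ ∈ L₁.formulas, ∃ φ₂ ∈ L₂.formulas, φ = .and φ₁ φ₂}
  | .bigOr k L => {φ | ∃ l : List (Fml S V), (∀ ψ ∈ l, ψ ∈ L.formulas) ∧ l.length ≤ k ∧ φ = .bigOr l}
  | .bigAnd L => {φ | ∃ l : List (Fml S V), (∀ ψ ∈ l, ψ ∈ L.formulas) ∧ l ≠ [] ∧ φ = .bigAnd l}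
  | .quant q X L => {φ | ∃ ψ ∈ L.formulas, φ = .quant q X ψ}
  | .quantAny X L => {φ | ∃ q : Quant, ∃ ψ ∈ L.formulas, φ = .quant q X ψ}

/-- The bottom formula of a bounded language. -/
def bot : BLang S V → Fml S V
  | .base _ => .atom ⊥
  | .or L₁ L₂ => .or L₁.bot L₂.bot
  | .and L₁ L₂ => .and L₁.bot L₂.bot
  | .bigOr _ _ => .bigOr []
  | .bigAnd L => .bigAnd [L.bot]
  | .quant q X L => .quant q X L.bot
  | .quantAny X L => .quant .all X L.bot

/-- Permuting the variables in `X` in formulas of the language captures no variable: each quantified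
set `Y` that is met, going inwards, is disjoint from `X`, until possibly one contains `X` (below
which no variable of `X` is free). -/
def NoCapture (X : Finset V) : BLang S V → Prop
  | .base _ => True
  | .or L₁ L₂ => L₁.NoCapture X ∧ L₂.NoCapture X
  | .and L₁ L₂ => L₁.NoCapture X ∧ L₂.NoCapture X
  | .bigOr _ L => L.NoCapture X
  | .bigAnd L => L.NoCapture X
  | .quant _ Y L => X ⊆ Y ∨ (Disjoint X Y ∧ L.NoCapture X)
  | .quantAny Y L => X ⊆ Y ∨ (Disjoint X Y ∧ L.NoCapture X)

/-- In every sublanguage that quantifies over some `X`, permuting the variables in `X` in the body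
captures no variable. -/
def CaptureFree : BLang S V → Prop
  | .base _ => True
  | .or L₁ L₂ => L₁.CaptureFree ∧ L₂.CaptureFree
  | .and L₁ L₂ => L₁.CaptureFree ∧ L₂.CaptureFree
  | .bigOr _ L => L.CaptureFree
  | .bigAnd L => L.CaptureFree
  | .quant _ X L => L.CaptureFree ∧ L.NoCapture X
  | .quantAny X L => L.CaptureFree ∧ L.NoCapture X

/-- `L.Sub φ ψ`: the formula `φ` subsumes `ψ` in the language `L`. It is only meant for formulas of
`L`, and `False` on formulas of a different shape. -/
def Sub : BLang S V → Fml S V → Fml S V → Prop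
  | .base _, .atom f, .atom g => f = ⊥ ∨ f = g
  | .or L₁ L₂, .or φ₁ φ₂, .or ψ₁ ψ₂ => L₁.Sub φ₁ ψ₁ ∧ L₂.Sub φ₂ ψ₂
  | .and L₁ L₂, .and φ₁ φ₂, .and ψ₁ ψ₂ => L₁.Sub φ₁ ψ₁ ∧ L₂.Sub φ₂ ψ₂
  | .bigOr _ L, .bigOr l, .bigOr l' =>
      ∃ m : Fin l.length → Fin l'.length,
        (∀ i, L.Sub (l.get i) (l'.get (m i))) ∧ Function.Injective m
  | .bigAnd L, .bigAnd l, .bigAnd l' =>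
      ∃ m : Fin l'.length → Fin l.length, ∀ i, L.Sub (l.get (m i)) (l'.get i)
  | .quant _ X L, .quant _ _ φ, .quant _ _ ψ => ∃ π ∈ permsOn X, L.Sub φ (ψ.subst π)
  | .quantAny X L, .quant q _ φ, .quant q' _ ψ =>
      (∃ π ∈ permsOn X, L.Sub φ (ψ.subst π)) ∧ (q = .all ∨ q' = .ex)
  | _, _, _ => False

/-- The order `≤` of the language `L` (a total order on canonical formulas). It is only meant for
formulas of `L`, and `False` on formulas of a different shape. Sequences under a disjunction are
compared lexicographically from the right: a suffix is smaller, and otherwise the rightmost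
difference decides. Sequences under a conjunction are compared lexicographically from the left: an
extension is smaller, and otherwise the leftmost difference decides. -/
def le : BLang S V → Fml S V → Fml S V → Prop
  | .base B, .atom f, .atom g => B.le f g
  | .or L₁ L₂, .or φ₁ φ₂, .or ψ₁ ψ₂ =>
      (L₁.le φ₁ ψ₁ ∧ φ₁ ≠ ψ₁) ∨ (φ₁ = ψ₁ ∧ L₂.le φ₂ ψ₂)
  | .and L₁ L₂, .and φ₁ φ₂, .and ψ₁ ψ₂ =>
      (L₁.le φ₁ ψ₁ ∧ φ₁ ≠ ψ₁) ∨ (φ₁ = ψ₁ ∧ L₂.le φ₂ ψ₂)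
  | .bigOr _ L, .bigOr l, .bigOr l' =>
      l <:+ l' ∨ ∃ (p p' t : List (Fml S V)) (a b : Fml S V),
        l = p ++ a :: t ∧ l' = p' ++ b :: t ∧ L.le a b ∧ a ≠ b
  | .bigAnd L, .bigAnd l, .bigAnd l' =>
      l' <+: l ∨ ∃ (p t t' : List (Fml S V)) (a b : Fml S V),
        l = p ++ a :: t ∧ l' = p ++ b :: t' ∧ L.le a b ∧ a ≠ b
  | .quant _ _ L, .quant _ _ φ, .quant _ _ ψ => L.le φ ψ
  | .quantAny _ L, .quant q _ φ, .quant q' _ ψ => (q = q' ∧ L.le φ ψ) ∨ (q = .all ∧ q' = .ex)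
  | _, _, _ => False

/-- The formulas in `F` that are not subsumed by other formulas in `F`. -/
def minSub (L : BLang S V) (F : Set (Fml S V)) : Set (Fml S V) :=
  {φ ∈ F | ∀ ψ ∈ F, ψ ≠ φ → ¬ L.Sub ψ φ}

open scoped Classical in
/-- The `≤`-least element of `F` (for a finite non-empty set `F` of canonical formulas). -/
def minLe (L : BLang S V) (F : Set (Fml S V)) : Fml S V :=
  if h : ∃ φ ∈ F, ∀ ψ ∈ F, L.le φ ψ then h.choose else L.bot

open scoped Classical in
/-- The sequence `l` sorted by `≤`, in ascending order (repetitions are kept). -/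
def sort (L : BLang S V) (l : List (Fml S V)) : List (Fml S V) := l.insertionSort L.le

open scoped Classical in
/-- The sequence of the elements of the finite set `F` sorted by `≤`, in ascending order. -/
def sortSet (L : BLang S V) (F : Set (Fml S V)) : List (Fml S V) :=
  if h : F.Finite then L.sort h.toFinset.toList else []

/-- The canonicalization function of the language `L`. It is only meant for formulas of `L`, and the
identity on formulas of a different shape. -/
def canon : BLang S V → Fml S V → Fml S V
  | .base _, φ => φ
  | .or L₁ L₂, .or φ₁ φ₂ => .or (L₁.canon φ₁) (L₂.canon φ₂)
  | .and L₁ L₂, .and φ₁ φ₂ => .and (L₁.canon φ₁) (L₂.canon φ₂)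
  | .bigOr _ L, .bigOr l => .bigOr (L.sort (l.map L.canon))
  | .bigAnd L, .bigAnd l => .bigAnd (L.sortSet (L.minSub {ψ | ∃ φ ∈ l, ψ = L.canon φ}))
  | .quant _ X L, .quant q Y φ =>
      .quant q Y (L.minLe {ψ | ∃ π ∈ permsOn X, ψ = L.canon (φ.subst π)})
  | .quantAny X L, .quant q Y φ =>
      .quant q Y (L.minLe {ψ | ∃ π ∈ permsOn X, ψ = L.canon (φ.subst π)})
  | _, φ => φ

/-- `φ` is a canonical formula of the language `L`. -/
def IsCanonical (L : BLang S V) (φ : Fml S V) : Prop := φ ∈ L.formulas ∧ L.canon φ = φ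

/-- The weaken operator of `L`, at the formula `φ` and the state given by `U` and `μ`. -/
def weaken [S.Structure U] (L : BLang S V) (φ : Fml S V) (μ : V → U) : Set (Fml S V) :=
  L.minSub {ξ | ∃ ψ ∈ L.formulas, L.Sub φ ψ ∧ ψ.Sat μ ∧ ξ = L.canon ψ}

/-- Iterated weakening of a formula along a sequence of states over the same structure `U`. -/
def iterWeaken [S.Structure U] (L : BLang S V) : Fml S V → List (V → U) → Set (Fml S V)
  | φ, [] => {φ}
  | φ, μ :: l => {ξ | ∃ ψ ∈ L.weaken φ μ, ξ ∈ L.iterWeaken ψ l}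

end BLang

end

/-!
For a formula `φ` of a capture-free bounded language `L`, the weakenings of `φ` at `μ` are the
`⊑`-minimal elements of `L.canonAbove φ μ`, the set of the canonical formulas `ξ` with `φ ⊑ ξ` that
hold at `μ`. Every rule of the theorem then has the same proof: the formulas that it lists, before
minimal ones are selected, lie in `L.canonAbove φ μ`, and each element of `L.canonAbove φ μ` is
subsumed by one of them. As `⊑` is a partial order on canonical formulas, both sets have the same
minimal elements (`BLang.minSub_eq_of_dominates`, `BLang.weaken_eq_minSub`). That the immediate
subformulas can be weakened separately is `BLang.exists_mem_weaken_sub`: a formula above `φ` that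
holds at `μ` is subsumed by a weakening of `φ`.

Four facts about bounded languages carry this, all proved by induction on the language.

* Subsumption is a preorder with least element `L.bot`, it is sound for entailment, and it is
  invariant under the permutations that `BLang.NoCapture` allows (`BLang.sub_trans`,
  `BLang.bot_sub`, `BLang.sat_of_sub`, `BLang.sub_subst`). Such a permutation of `X` meets only
  quantified sets disjoint from `X`, which it fixes pointwise, until it meets one that contains `X`,
  below which it acts as the identity; so substitution is a group action
  (`BLang.subst_subst`).
* `L.le` is a linear order on all of `L.formulas` (`BLang.le_isLinearOrderOn`). Hence sorting depends
  only on the multiset of the entries, and the least elements taken by the canonicalization of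
  quantified formulas exist.
* Canonicalization picks one representative from each class of mutual subsumption
  (`BLang.canonRepresents`). For disjunctions and for quantifiers, mutual subsumption only gives
  `φ ⊑ f φ` for an injective map `f` of a finite index set or of the finite set of permutations of
  `X`; iterating `f` returns to `φ`, so `φ` and `f φ` are equivalent
  (`rel_of_injective_of_finite`).
* There are finitely many canonical formulas (`BLang.finite_isCanonical`), so every one of them is
  above a minimal one.
-/

/-! ### Relabelling of first-order formulas -/

section Relabel

open FirstOrder Language

variable {S : FirstOrder.Language.{u, v}} {V : Type w}

/-- Relabelling along a map between variables involves no bound variables, so up to a cast of the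
number of bound variables it maps all terms along `Sum.map g id`. -/
theorem relabel_sumInl_comp_eq {n : ℕ} (g : V → V) (f : S.BoundedFormula V n) :
    (f.relabel (Sum.inl ∘ g : V → V ⊕ Fin 0) : S.BoundedFormula V (0 + n)) =
      (f.mapTermRel (fun _ t => t.relabel (Sum.map g id)) (fun _ => id) fun _ => id :
        S.BoundedFormula V n).castLE (zero_add n).ge := by
  have aux : ∀ k, BoundedFormula.relabelAux (Sum.inl ∘ g : V → V ⊕ Fin 0) k =
      Sum.map id (Fin.castLE (zero_add k).ge) ∘ Sum.map g id := by
    intro k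
    ext a
    rcases a with a | a <;> simp [BoundedFormula.relabelAux]
    ext
    simp
  simp only [BoundedFormula.relabel, aux]
  induction f with
  | falsum => rfl
  | equal => simp [BoundedFormula.mapTermRel, BoundedFormula.castLE]
  | rel =>
    simp only [BoundedFormula.mapTermRel, BoundedFormula.castLE, id]
    congr 1
    funext i
    simp
  | imp _ _ ih1 ih2 => simp_all [BoundedFormula.mapTermRel]
  | all _ ih => simp_all [BoundedFormula.mapTermRel]

theorem formula_relabel_eq (g : V → V) (f : S.Formula V) :
    f.relabel g =
      (f.mapTermRel (fun _ t => t.relabel (Sum.map g id)) (fun _ => id) fun _ => id :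
        S.BoundedFormula V 0) := by
  rw [Formula.relabel, relabel_sumInl_comp_eq]
  exact BoundedFormula.castLE_rfl _ _

theorem formula_relabel_id (f : S.Formula V) : f.relabel id = f := by
  rw [formula_relabel_eq]
  simp only [Sum.map_id_id, Term.relabel_id]
  exact BoundedFormula.mapTermRel_id_id_id f

theorem formula_relabel_relabel (g h : V → V) (f : S.Formula V) :
    (f.relabel g).relabel h = f.relabel (h ∘ g) := by
  rw [formula_relabel_eq, formula_relabel_eq, formula_relabel_eq,
    BoundedFormula.mapTermRel_mapTermRel]
  congr 1
  funext n t
  simp [Term.relabel_relabel]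

end Relabel

/-! ### Permutations acting on the formulas of a bounded language -/

section Subst

variable {S : FirstOrder.Language.{u, v}} {V : Type w} {U : Type x} {X Y : Finset V}

theorem one_mem_permsOn : (1 : Equiv.Perm V) ∈ permsOn X := fun _ _ => rfl

theorem inv_mem_permsOn {π : Equiv.Perm V} (h : π ∈ permsOn X) : π⁻¹ ∈ permsOn X := by
  intro a ha
  rw [Equiv.Perm.inv_eq_iff_eq, h a ha]

theorem mul_mem_permsOn {π ρ : Equiv.Perm V} (hπ : π ∈ permsOn X) (hρ : ρ ∈ permsOn X) :
    π * ρ ∈ permsOn X := by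
  intro a ha
  rw [Equiv.Perm.mul_apply, hρ a ha, hπ a ha]

theorem apply_mem_iff_of_mem_permsOn {π : Equiv.Perm V} (hπ : π ∈ permsOn X) {a : V} :
    π a ∈ X ↔ a ∈ X := by
  constructor
  · intro h
    by_contra ha
    exact ha (hπ a ha ▸ h)
  · intro h
    by_contra ha
    have := π.injective (hπ _ ha)
    exact ha (by rwa [this])

theorem permsOn_finite (X : Finset V) : (permsOn X).Finite := by
  classical
  let F : permsOn X → (X → X) :=
    fun π a => ⟨π.1 a, (apply_mem_iff_of_mem_permsOn π.2).2 a.2⟩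
  have : Function.Injective F := by
    intro π ρ h
    apply Subtype.ext
    ext a
    by_cases ha : a ∈ X
    · exact congrArg Subtype.val (congrFun h ⟨a, ha⟩)
    · rw [π.2 a ha, ρ.2 a ha]
  exact Finite.of_injective F this

theorem mul_comm_of_disjoint {π ρ : Equiv.Perm V} (hπ : π ∈ permsOn X) (hρ : ρ ∈ permsOn Y)
    (h : Disjoint X Y) : π * ρ = ρ * π := by
  ext a
  rw [Equiv.Perm.mul_apply, Equiv.Perm.mul_apply]
  by_cases ha : a ∈ X
  · have h1 : a ∉ Y := Finset.disjoint_left.1 h ha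
    have h2 : π a ∉ Y := Finset.disjoint_left.1 h ((apply_mem_iff_of_mem_permsOn hπ).2 ha)
    rw [hρ _ h1, hρ _ h2]
  · by_cases hb : a ∈ Y
    · have h2 : ρ a ∉ X := Finset.disjoint_right.1 h ((apply_mem_iff_of_mem_permsOn hρ).2 hb)
      rw [hπ _ ha, hπ _ h2]
    · rw [hπ _ ha, hρ _ hb, hπ _ ha]

theorem subst_quant_of_subset {π : Equiv.Perm V} (hπ : π ∈ permsOn X) (h : X ⊆ Y) (q : Quant)
    (φ : Fml S V) : (Fml.quant q Y φ).subst π = .quant q Y (φ.subst id) := by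
  rw [Fml.subst]
  congr 2
  funext a
  split_ifs with ha
  · rfl
  · exact hπ a fun h' => ha (h h')

theorem subst_quant_of_disjoint {π : Equiv.Perm V} (hπ : π ∈ permsOn X) (h : Disjoint X Y)
    (q : Quant) (φ : Fml S V) : (Fml.quant q Y φ).subst π = .quant q Y (φ.subst π) := by
  rw [Fml.subst]
  congr 2
  funext a
  split_ifs with ha
  · exact (hπ a (Finset.disjoint_right.1 h ha)).symm
  · rfl

theorem subst_id (φ : Fml S V) : φ.subst id = φ := by
  have key : ∀ (g : V → V) (φ : Fml S V), g = id → φ.subst g = φ := by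
    intro g φ
    induction g, φ using Fml.subst.induct with
    | case1 g f => rintro rfl; rw [Fml.subst, formula_relabel_id]
    | case2 g φ ψ ih1 ih2 => intro h; rw [Fml.subst, ih1 h, ih2 h]
    | case3 g φ ψ ih1 ih2 => intro h; rw [Fml.subst, ih1 h, ih2 h]
    | case4 g l ih =>
      intro h
      rw [Fml.subst, List.map_congr_left fun φ hφ => ih φ hφ h, List.map_id']
    | case5 g l ih =>
      intro h
      rw [Fml.subst, List.map_congr_left fun φ hφ => ih φ hφ h, List.map_id']
    | case6 g q Y φ ih =>
      rintro rfl
      rw [Fml.subst]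
      exact congrArg _ (ih (by funext a; simp))
  exact key id φ rfl

theorem subst_one (φ : Fml S V) : φ.subst (1 : Equiv.Perm V) = φ := subst_id φ

namespace BLang

variable {L : BLang S V}

theorem subst_subst {π ρ : Equiv.Perm V} (hπ : π ∈ permsOn X) (hρ : ρ ∈ permsOn X)
    (hL : L.NoCapture X) {φ : Fml S V} (hφ : φ ∈ L.formulas) :
    (φ.subst π).subst ρ = φ.subst (ρ * π : Equiv.Perm V) := by
  induction L generalizing φ with
  | base B =>
    obtain ⟨f, -, rfl⟩ := hφ
    simp only [Fml.subst, formula_relabel_relabel, Equiv.Perm.coe_mul]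
  | or L₁ L₂ ih₁ ih₂ =>
    obtain ⟨φ₁, h₁, φ₂, h₂, rfl⟩ := hφ
    simp only [Fml.subst, ih₁ hL.1 h₁, ih₂ hL.2 h₂]
  | and L₁ L₂ ih₁ ih₂ =>
    obtain ⟨φ₁, h₁, φ₂, h₂, rfl⟩ := hφ
    simp only [Fml.subst, ih₁ hL.1 h₁, ih₂ hL.2 h₂]
  | bigOr k L ih =>
    obtain ⟨l, hl, -, rfl⟩ := hφ
    simp only [Fml.subst, List.map_map]
    congr 1
    exact List.map_congr_left fun ψ hψ => ih hL (hl ψ hψ)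
  | bigAnd L ih =>
    obtain ⟨l, hl, -, rfl⟩ := hφ
    simp only [Fml.subst, List.map_map]
    congr 1
    exact List.map_congr_left fun ψ hψ => ih hL (hl ψ hψ)
  | quant q Y L ih =>
    obtain ⟨ψ, hψ, rfl⟩ := hφ
    rcases hL with hL | ⟨hd, hL⟩
    · simp only [subst_quant_of_subset hπ hL, subst_quant_of_subset hρ hL,
        subst_quant_of_subset (mul_mem_permsOn hρ hπ) hL, subst_id]
    · rw [subst_quant_of_disjoint hπ hd, subst_quant_of_disjoint hρ hd,
        subst_quant_of_disjoint (mul_mem_permsOn hρ hπ) hd, ih hL hψ]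
  | quantAny Y L ih =>
    obtain ⟨q, ψ, hψ, rfl⟩ := hφ
    rcases hL with hL | ⟨hd, hL⟩
    · simp only [subst_quant_of_subset hπ hL, subst_quant_of_subset hρ hL,
        subst_quant_of_subset (mul_mem_permsOn hρ hπ) hL, subst_id]
    · rw [subst_quant_of_disjoint hπ hd, subst_quant_of_disjoint hρ hd,
        subst_quant_of_disjoint (mul_mem_permsOn hρ hπ) hd, ih hL hψ]

theorem subst_subst_comm {π ρ : Equiv.Perm V} (hπ : π ∈ permsOn X) (hρ : ρ ∈ permsOn Y)
    (hXY : Disjoint X Y) (hX : L.NoCapture X) (hY : L.NoCapture Y) {φ : Fml S V}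
    (hφ : φ ∈ L.formulas) : (φ.subst π).subst ρ = (φ.subst ρ).subst π := by
  have quant_case : ∀ (q : Quant) (Z : Finset V) (L : BLang S V) (ψ : Fml S V),
      (X ⊆ Z ∨ (Disjoint X Z ∧ L.NoCapture X)) → (Y ⊆ Z ∨ (Disjoint Y Z ∧ L.NoCapture Y)) →
      (L.NoCapture X → L.NoCapture Y → (ψ.subst π).subst ρ = (ψ.subst ρ).subst π) →
      ((Fml.quant q Z ψ).subst π).subst ρ = ((Fml.quant q Z ψ).subst ρ).subst π := by
    rintro q Z L ψ (hX | ⟨hdX, hX⟩) (hY | ⟨hdY, hY⟩) ih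
    · simp only [subst_quant_of_subset hπ hX, subst_quant_of_subset hρ hY, subst_id]
    · simp only [subst_quant_of_subset hπ hX, subst_quant_of_disjoint hρ hdY, subst_id]
    · simp only [subst_quant_of_subset hρ hY, subst_quant_of_disjoint hπ hdX, subst_id]
    · simp only [subst_quant_of_disjoint hρ hdY, subst_quant_of_disjoint hπ hdX, ih hX hY]
  induction L generalizing φ with
  | base B =>
    obtain ⟨f, -, rfl⟩ := hφ
    simp only [Fml.subst, formula_relabel_relabel]
    rw [← Equiv.Perm.coe_mul, ← Equiv.Perm.coe_mul, mul_comm_of_disjoint hπ hρ hXY]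
  | or L₁ L₂ ih₁ ih₂ =>
    obtain ⟨φ₁, h₁, φ₂, h₂, rfl⟩ := hφ
    simp only [Fml.subst, ih₁ hX.1 hY.1 h₁, ih₂ hX.2 hY.2 h₂]
  | and L₁ L₂ ih₁ ih₂ =>
    obtain ⟨φ₁, h₁, φ₂, h₂, rfl⟩ := hφ
    simp only [Fml.subst, ih₁ hX.1 hY.1 h₁, ih₂ hX.2 hY.2 h₂]
  | bigOr k L ih =>
    obtain ⟨l, hl, -, rfl⟩ := hφ
    simp only [Fml.subst, List.map_map]
    congr 1
    exact List.map_congr_left fun ψ hψ => ih hX hY (hl ψ hψ)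
  | bigAnd L ih =>
    obtain ⟨l, hl, -, rfl⟩ := hφ
    simp only [Fml.subst, List.map_map]
    congr 1
    exact List.map_congr_left fun ψ hψ => ih hX hY (hl ψ hψ)
  | quant q Z L ih =>
    obtain ⟨ψ, hψ, rfl⟩ := hφ
    exact quant_case q Z L ψ hX hY fun h h' => ih h h' hψ
  | quantAny Z L ih =>
    obtain ⟨q, ψ, hψ, rfl⟩ := hφ
    exact quant_case q Z L ψ hX hY fun h h' => ih h h' hψ

theorem subst_mem {π : Equiv.Perm V} (hπ : π ∈ permsOn X) (hL : L.NoCapture X) {φ : Fml S V}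
    (hφ : φ ∈ L.formulas) : φ.subst π ∈ L.formulas := by
  induction L generalizing φ with
  | base B =>
    obtain ⟨f, hf, rfl⟩ := hφ
    rw [Fml.subst]
    refine ⟨_, ?_, rfl⟩
    rcases hf with rfl | hf
    · exact Or.inl rfl
    · exact Or.inr (B.closed π f hf)
  | or L₁ L₂ ih₁ ih₂ =>
    obtain ⟨φ₁, h₁, φ₂, h₂, rfl⟩ := hφ
    rw [Fml.subst]
    exact ⟨_, ih₁ hL.1 h₁, _, ih₂ hL.2 h₂, rfl⟩
  | and L₁ L₂ ih₁ ih₂ =>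
    obtain ⟨φ₁, h₁, φ₂, h₂, rfl⟩ := hφ
    rw [Fml.subst]
    exact ⟨_, ih₁ hL.1 h₁, _, ih₂ hL.2 h₂, rfl⟩
  | bigOr k L ih =>
    obtain ⟨l, hl, hk, rfl⟩ := hφ
    rw [Fml.subst]
    refine ⟨_, ?_, by simpa using hk, rfl⟩
    rw [List.forall_mem_map]
    exact fun ψ hψ => ih hL (hl ψ hψ)
  | bigAnd L ih =>
    obtain ⟨l, hl, hk, rfl⟩ := hφ
    rw [Fml.subst]
    refine ⟨_, ?_, by simpa using hk, rfl⟩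
    rw [List.forall_mem_map]
    exact fun ψ hψ => ih hL (hl ψ hψ)
  | quant q Y L ih =>
    obtain ⟨ψ, hψ, rfl⟩ := hφ
    rcases hL with hL | ⟨hd, hL⟩
    · rw [subst_quant_of_subset hπ hL, subst_id]
      exact ⟨ψ, hψ, rfl⟩
    · rw [subst_quant_of_disjoint hπ hd]
      exact ⟨_, ih hL hψ, rfl⟩
  | quantAny Y L ih =>
    obtain ⟨q, ψ, hψ, rfl⟩ := hφ
    rcases hL with hL | ⟨hd, hL⟩
    · rw [subst_quant_of_subset hπ hL, subst_id]
      exact ⟨q, ψ, hψ, rfl⟩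
    · rw [subst_quant_of_disjoint hπ hd]
      exact ⟨q, _, ih hL hψ, rfl⟩

theorem subst_inv_subst {π : Equiv.Perm V} (hπ : π ∈ permsOn X) (hL : L.NoCapture X)
    {φ : Fml S V} (hφ : φ ∈ L.formulas) :
    (φ.subst π).subst (π⁻¹ : Equiv.Perm V) = φ := by
  rw [subst_subst hπ (inv_mem_permsOn hπ) hL hφ, inv_mul_cancel, subst_one]

end BLang

/-! ### Permutations and satisfaction -/

theorem updateOn_comp_of_disjoint {π : Equiv.Perm V} (hπ : π ∈ permsOn X) (h : Disjoint X Y)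
    (μ : V → U) (ν : Y → U) : updateOn μ ν ∘ π = updateOn (μ ∘ π) ν := by
  funext a
  by_cases ha : a ∈ Y
  · rw [Function.comp_apply, hπ a (Finset.disjoint_right.1 h ha)]
    simp [updateOn, ha]
  · have hb : π a ∉ Y := by
      intro hb
      have := π.injective (hπ _ (Finset.disjoint_right.1 h hb))
      exact ha (this ▸ hb)
    simp [updateOn, ha, hb]

theorem updateOn_comp_of_subset {π : Equiv.Perm V} (hπ : π ∈ permsOn X) (h : X ⊆ Y)
    (μ : V → U) (ν : Y → U) : updateOn (μ ∘ π) ν = updateOn μ ν := by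
  funext a
  by_cases ha : a ∈ Y
  · simp [updateOn, ha]
  · simp [updateOn, ha, hπ a fun h' => ha (h h')]

/-- Permuting the updated variables amounts to permuting the update. -/
theorem updateOn_comp_perm {π : Equiv.Perm V} (hπ : π ∈ permsOn X) (μ : V → U) (ν : X → U) :
    ∃ ν' : X → U, updateOn μ ν ∘ π = updateOn μ ν' := by
  refine ⟨fun a => updateOn μ ν (π a), ?_⟩
  funext a
  by_cases ha : a ∈ X
  · simp only [Function.comp_apply]
    conv_rhs => rw [updateOn]
    simp [ha]
  · simp [updateOn, ha, hπ a ha]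

variable [S.Structure U]

theorem BLang.sat_subst {L : BLang S V} {π : Equiv.Perm V} (hπ : π ∈ permsOn X)
    (hL : L.NoCapture X) {φ : Fml S V} (hφ : φ ∈ L.formulas) (μ : V → U) :
    (φ.subst π).Sat μ ↔ φ.Sat (μ ∘ π) := by
  have quant_case : ∀ (q : Quant) (Z : Finset V) (L : BLang S V) (ψ : Fml S V) (μ : V → U),
      (X ⊆ Z ∨ (Disjoint X Z ∧ L.NoCapture X)) →
      (L.NoCapture X → ∀ μ : V → U, (ψ.subst π).Sat μ ↔ ψ.Sat (μ ∘ π)) →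
      (((Fml.quant q Z ψ).subst π).Sat μ ↔ (Fml.quant q Z ψ).Sat (μ ∘ π)) := by
    rintro q Z L ψ μ (hX | ⟨hdX, hX⟩) ih
    · rw [subst_quant_of_subset hπ hX, subst_id]
      cases q <;> simp only [Fml.Sat, updateOn_comp_of_subset hπ hX]
    · rw [subst_quant_of_disjoint hπ hdX]
      cases q <;> simp only [Fml.Sat, ← updateOn_comp_of_disjoint hπ hdX, ih hX]
  induction L generalizing φ μ with
  | base B =>
    obtain ⟨f, -, rfl⟩ := hφ
    simp only [Fml.subst, Fml.Sat]
    exact FirstOrder.Language.Formula.realize_relabel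
  | or L₁ L₂ ih₁ ih₂ =>
    obtain ⟨φ₁, h₁, φ₂, h₂, rfl⟩ := hφ
    simp only [Fml.subst, Fml.Sat, ih₁ hL.1 h₁ μ,
      ih₂ hL.2 h₂ μ]
  | and L₁ L₂ ih₁ ih₂ =>
    obtain ⟨φ₁, h₁, φ₂, h₂, rfl⟩ := hφ
    simp only [Fml.subst, Fml.Sat, ih₁ hL.1 h₁ μ,
      ih₂ hL.2 h₂ μ]
  | bigOr k L ih =>
    obtain ⟨l, hl, -, rfl⟩ := hφ
    simp only [Fml.subst, Fml.Sat, exists_prop, List.mem_map, exists_exists_and_eq_and]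
    exact exists_congr fun ψ => and_congr_right fun hψ => ih hL (hl ψ hψ) μ
  | bigAnd L ih =>
    obtain ⟨l, hl, -, rfl⟩ := hφ
    simp only [Fml.subst, Fml.Sat, List.forall_mem_map]
    exact forall₂_congr fun ψ hψ => ih hL (hl ψ hψ) μ
  | quant q Z L ih =>
    obtain ⟨ψ, hψ, rfl⟩ := hφ
    exact quant_case q Z L ψ μ hL fun h μ => ih h hψ μ
  | quantAny Z L ih =>
    obtain ⟨q, ψ, hψ, rfl⟩ := hφ
    exact quant_case q Z L ψ μ hL fun h μ => ih h hψ μ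

end Subst

/-! ### Linear orders on a set, lexicographic comparison, sorting -/

section Order

variable {α : Type*} {β : Type*}

/-- The relation `r` is a linear order on the elements of `s`; nothing is said about the others. -/
structure IsLinearOrderOn (r : α → α → Prop) (s : Set α) : Prop where
  total : ∀ a ∈ s, ∀ b ∈ s, r a b ∨ r b a
  trans : ∀ a ∈ s, ∀ b ∈ s, ∀ c ∈ s, r a b → r b c → r a c
  antisymm : ∀ a ∈ s, ∀ b ∈ s, r a b → r b a → a = b

namespace IsLinearOrderOn

variable {r : α → α → Prop} {s : Set α}

theorem refl (h : IsLinearOrderOn r s) {a : α} (ha : a ∈ s) : r a a :=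
  (h.total a ha a ha).elim id id

theorem flip (h : IsLinearOrderOn r s) : IsLinearOrderOn (flip r) s where
  total a ha b hb := h.total b hb a ha
  trans a ha b hb c hc hab hbc := h.trans c hc b hb a ha hbc hab
  antisymm a ha b hb hab hba := h.antisymm a ha b hb hba hab

theorem of_subset_image (h : IsLinearOrderOn r s) {r' : β → β → Prop} {t : Set β} (g : α → β)
    (ht : ∀ x ∈ t, ∃ a ∈ s, g a = x) (hg : ∀ a ∈ s, ∀ b ∈ s, r' (g a) (g b) ↔ r a b) :
    IsLinearOrderOn r' t where
  total x hx y hy := by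
    obtain ⟨a, ha, rfl⟩ := ht x hx
    obtain ⟨b, hb, rfl⟩ := ht y hy
    rw [hg a ha b hb, hg b hb a ha]
    exact h.total a ha b hb
  trans x hx y hy z hz := by
    obtain ⟨a, ha, rfl⟩ := ht x hx
    obtain ⟨b, hb, rfl⟩ := ht y hy
    obtain ⟨c, hc, rfl⟩ := ht z hz
    rw [hg a ha b hb, hg b hb c hc, hg a ha c hc]
    exact h.trans a ha b hb c hc
  antisymm x hx y hy := by
    obtain ⟨a, ha, rfl⟩ := ht x hx
    obtain ⟨b, hb, rfl⟩ := ht y hy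
    rw [hg a ha b hb, hg b hb a ha]
    exact fun hab hba => congrArg g (h.antisymm a ha b hb hab hba)

theorem exists_least (h : IsLinearOrderOn r s) {F : Set α} (hF : F.Finite) (hne : F.Nonempty)
    (hFs : F ⊆ s) : ∃ a ∈ F, ∀ b ∈ F, r a b := by
  induction F, hF using Set.Finite.induction_on with
  | empty => exact absurd hne Set.not_nonempty_empty
  | @insert a F _ _ ih =>
    have ha : a ∈ s := hFs (Set.mem_insert _ _)
    have hF' : F ⊆ s := fun b hb => hFs (Set.mem_insert_of_mem _ hb)
    rcases F.eq_empty_or_nonempty with rfl | hne'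
    · refine ⟨a, Set.mem_insert _ _, fun b hb => ?_⟩
      rcases hb with rfl | hb
      · exact h.refl ha
      · exact hb.elim
    · obtain ⟨m, hm, hmin⟩ := ih hne' hF'
      rcases h.total a ha m (hF' hm) with ham | hma
      · refine ⟨a, Set.mem_insert _ _, ?_⟩
        rintro b (rfl | hb)
        · exact h.refl ha
        · exact h.trans a ha m (hF' hm) b (hF' hb) ham (hmin b hb)
      · refine ⟨m, Set.mem_insert_of_mem _ hm, ?_⟩
        rintro b (rfl | hb)
        · exact hma
        · exact hmin b hb

open scoped Classical in
theorem pairwise_insertionSort (h : IsLinearOrderOn r s) {l : List α} (hl : ∀ a ∈ l, a ∈ s) :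
    (l.insertionSort r).Pairwise r := by
  let r' : s → s → Prop := fun a b => r a b
  have : Std.Total r' := ⟨fun a b => h.total a a.2 b b.2⟩
  have : IsTrans s r' := ⟨fun a b c => h.trans a a.2 b b.2 c c.2⟩
  lift l to List s using hl
  rw [← List.map_insertionSort r' r Subtype.val l fun a _ b _ => Iff.rfl, List.pairwise_map]
  exact List.pairwise_insertionSort r' l

open scoped Classical in
theorem insertionSort_eq_of_perm (h : IsLinearOrderOn r s) {l l' : List α}
    (hl : ∀ a ∈ l, a ∈ s) (hp : l.Perm l') : l.insertionSort r = l'.insertionSort r := by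
  refine List.Perm.eq_of_pairwise (le := r) ?_ (h.pairwise_insertionSort hl)
    (h.pairwise_insertionSort fun a ha => hl a (hp.mem_iff.2 ha))
    ((List.perm_insertionSort r l).trans (hp.trans (List.perm_insertionSort r l').symm))
  intro a b ha hb
  exact h.antisymm a (hl a ((List.mem_insertionSort r).1 ha)) b
    (hl b (hp.mem_iff.2 ((List.mem_insertionSort r).1 hb)))

end IsLinearOrderOn

/-- At the leftmost position where the sequences differ, the entry of the first one is smaller. -/
def LexDiff (r : α → α → Prop) (l l' : List α) : Prop :=
  ∃ (p t t' : List α) (a b : α), l = p ++ a :: t ∧ l' = p ++ b :: t' ∧ r a b ∧ a ≠ b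

/-- Lexicographic comparison of sequences from the left, where an extension of a sequence is
smaller. -/
def PrefixLex (r : α → α → Prop) (l l' : List α) : Prop := l' <+: l ∨ LexDiff r l l'

theorem lexDiff_cons_cons {r : α → α → Prop} {a b : α} {l l' : List α} :
    LexDiff r (a :: l) (b :: l') ↔ (r a b ∧ a ≠ b) ∨ (a = b ∧ LexDiff r l l') := by
  constructor
  · rintro ⟨p, t, t', c, d, h1, h2, hcd⟩
    cases p with
    | nil =>
      simp only [List.nil_append, List.cons.injEq] at h1 h2
      rw [h1.1, h2.1]
      exact Or.inl hcd
    | cons e p =>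
      simp only [List.cons_append, List.cons.injEq] at h1 h2
      exact Or.inr ⟨h1.1.trans h2.1.symm, p, t, t', c, d, h1.2, h2.2, hcd⟩
  · rintro (h | ⟨rfl, p, t, t', c, d, rfl, rfl, hcd⟩)
    · exact ⟨[], l, l', a, b, rfl, rfl, h⟩
    · exact ⟨a :: p, t, t', c, d, rfl, rfl, hcd⟩

theorem prefixLex_nil_right {r : α → α → Prop} (l : List α) : PrefixLex r l [] :=
  Or.inl List.nil_prefix

theorem not_prefixLex_nil_cons {r : α → α → Prop} {b : α} {l : List α} :
    ¬ PrefixLex r [] (b :: l) := by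
  rintro (h | ⟨p, t, t', c, d, h1, -⟩)
  · simp at h
  · simp at h1

theorem prefixLex_cons_cons {r : α → α → Prop} {a b : α} {l l' : List α} :
    PrefixLex r (a :: l) (b :: l') ↔ (r a b ∧ a ≠ b) ∨ (a = b ∧ PrefixLex r l l') := by
  rw [PrefixLex, lexDiff_cons_cons, List.cons_prefix_cons, PrefixLex]
  constructor
  · rintro (⟨rfl, h⟩ | h | ⟨h, h'⟩)
    · exact Or.inr ⟨rfl, Or.inl h⟩
    · exact Or.inl h
    · exact Or.inr ⟨h, Or.inr h'⟩
  · rintro (h | ⟨rfl, h | h⟩)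
    · exact Or.inr (Or.inl h)
    · exact Or.inl ⟨rfl, h⟩
    · exact Or.inr (Or.inr ⟨rfl, h⟩)

theorem IsLinearOrderOn.prod {r₁ : α → α → Prop} {s₁ : Set α} {r₂ : β → β → Prop} {s₂ : Set β}
    (h₁ : IsLinearOrderOn r₁ s₁) (h₂ : IsLinearOrderOn r₂ s₂) :
    IsLinearOrderOn (fun a b : α × β => (r₁ a.1 b.1 ∧ a.1 ≠ b.1) ∨ (a.1 = b.1 ∧ r₂ a.2 b.2))
      (s₁ ×ˢ s₂) where
  total := by
    rintro ⟨a, a'⟩ ⟨ha, ha'⟩ ⟨b, b'⟩ ⟨hb, hb'⟩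
    by_cases hab : a = b
    · rcases h₂.total a' ha' b' hb' with h | h
      · exact Or.inl (Or.inr ⟨hab, h⟩)
      · exact Or.inr (Or.inr ⟨hab.symm, h⟩)
    · rcases h₁.total a ha b hb with h | h
      · exact Or.inl (Or.inl ⟨h, hab⟩)
      · exact Or.inr (Or.inl ⟨h, Ne.symm hab⟩)
  trans := by
    rintro ⟨a, a'⟩ ⟨ha, ha'⟩ ⟨b, b'⟩ ⟨hb, hb'⟩ ⟨c, c'⟩ ⟨hc, hc'⟩ h h'
    simp only at *
    rcases h with ⟨h, hne⟩ | ⟨rfl, h⟩ <;> rcases h' with ⟨h', hne'⟩ | ⟨rfl, h'⟩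
    · refine Or.inl ⟨h₁.trans a ha b hb c hc h h', ?_⟩
      rintro rfl
      exact hne (h₁.antisymm a ha b hb h h')
    · exact Or.inl ⟨h, hne⟩
    · exact Or.inl ⟨h', hne'⟩
    · exact Or.inr ⟨rfl, h₂.trans a' ha' b' hb' c' hc' h h'⟩
  antisymm := by
    rintro ⟨a, a'⟩ ⟨ha, ha'⟩ ⟨b, b'⟩ ⟨hb, hb'⟩ h h'
    simp only at *
    rcases h with ⟨h, hne⟩ | ⟨rfl, h⟩ <;> rcases h' with ⟨h', hne'⟩ | ⟨hh, h'⟩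
    · exact absurd (h₁.antisymm a ha b hb h h') hne
    · exact absurd hh.symm hne
    · exact absurd rfl hne'
    · rw [h₂.antisymm a' ha' b' hb' h h']

theorem IsLinearOrderOn.prefixLex {r : α → α → Prop} {s : Set α} (h : IsLinearOrderOn r s) :
    IsLinearOrderOn (PrefixLex r) {l | ∀ a ∈ l, a ∈ s} where
  total := by
    intro l
    induction l with
    | nil => exact fun _ l' _ => Or.inr (prefixLex_nil_right l')
    | cons a l ih =>
      rintro hl (_ | ⟨b, l'⟩) hl'
      · exact Or.inl (prefixLex_nil_right _)
      · simp only [Set.mem_ofPred_eq, List.forall_mem_cons] at hl hl'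
        simp only [prefixLex_cons_cons]
        by_cases hab : a = b
        · rcases ih hl.2 l' hl'.2 with h | h
          · exact Or.inl (Or.inr ⟨hab, h⟩)
          · exact Or.inr (Or.inr ⟨hab.symm, h⟩)
        · rcases h.total a hl.1 b hl'.1 with h | h
          · exact Or.inl (Or.inl ⟨h, hab⟩)
          · exact Or.inr (Or.inl ⟨h, Ne.symm hab⟩)
  trans := by
    intro l
    induction l with
    | nil =>
      rintro hl (_ | ⟨b, l'⟩) hl' l'' hl'' h1 h2
      · exact h2
      · exact absurd h1 not_prefixLex_nil_cons
    | cons a l ih =>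
      rintro hl (_ | ⟨b, l'⟩) hl' (_ | ⟨c, l''⟩) hl'' h1 h2
      · exact h1
      · exact absurd h2 not_prefixLex_nil_cons
      · exact prefixLex_nil_right _
      · simp only [Set.mem_ofPred_eq, List.forall_mem_cons] at hl hl' hl''
        rw [prefixLex_cons_cons] at h1 h2 ⊢
        rcases h1 with ⟨h1, hne⟩ | ⟨rfl, h1⟩ <;> rcases h2 with ⟨h2, hne'⟩ | ⟨rfl, h2⟩
        · refine Or.inl ⟨h.trans a hl.1 b hl'.1 c hl''.1 h1 h2, ?_⟩
          rintro rfl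
          exact hne (h.antisymm a hl.1 b hl'.1 h1 h2)
        · exact Or.inl ⟨h1, hne⟩
        · exact Or.inl ⟨h2, hne'⟩
        · exact Or.inr ⟨rfl, ih hl.2 l' hl'.2 l'' hl''.2 h1 h2⟩
  antisymm := by
    intro l
    induction l with
    | nil =>
      rintro hl (_ | ⟨b, l'⟩) hl' h1 h2
      · rfl
      · exact absurd h1 not_prefixLex_nil_cons
    | cons a l ih =>
      rintro hl (_ | ⟨b, l'⟩) hl' h1 h2
      · exact absurd h2 not_prefixLex_nil_cons
      · simp only [Set.mem_ofPred_eq, List.forall_mem_cons] at hl hl'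
        rw [prefixLex_cons_cons] at h1 h2
        rcases h1 with ⟨h1, hne⟩ | ⟨rfl, h1⟩ <;> rcases h2 with ⟨h2, hne'⟩ | ⟨hh, h2⟩
        · exact absurd (h.antisymm a hl.1 b hl'.1 h1 h2) hne
        · exact absurd hh.symm hne
        · exact absurd rfl hne'
        · rw [ih hl.2 l' hl'.2 h1 h2]

/-- A relation that goes up along an injective self-map of a finite type also goes down along it,
because every point returns to itself. -/
theorem rel_of_injective_of_finite [Finite α] {r : α → α → Prop}
    (hr : ∀ a, r a a) (ht : ∀ a b c, r a b → r b c → r a c) {f : α → α}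
    (hf : Function.Injective f) (h : ∀ a, r a (f a)) (a : α) : r (f a) a := by
  have hit : ∀ n b, r b (f^[n] b) := by
    intro n
    induction n with
    | zero => exact hr
    | succ n ih =>
      intro b
      rw [Function.iterate_succ_apply']
      exact ht _ _ _ (ih b) (h _)
  obtain ⟨n, hn, hper⟩ := hf.mem_periodicPts a
  have h1 := hit (n - 1) (f a)
  rw [← Function.iterate_succ_apply, Nat.succ_eq_add_one, Nat.sub_add_cancel hn] at h1
  rwa [hper.eq] at h1

theorem List.Perm.exists_injective {l l' : List α} (h : l.Perm l') :
    ∃ m : Fin l.length → Fin l'.length, (∀ i, l.get i = l'.get (m i)) ∧ Function.Injective m := by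
  induction h with
  | nil => exact ⟨id, fun i => rfl, fun _ _ h => h⟩
  | @cons a l l' _ ih =>
    obtain ⟨m, hm, hinj⟩ := ih
    refine ⟨Fin.cases (0 : Fin (l'.length + 1)) fun i => (m i).succ, ?_, ?_⟩
    · intro i
      refine Fin.cases rfl (fun j => ?_) i
      exact hm j
    · intro i j
      refine Fin.cases ?_ (fun i => ?_) i <;> refine Fin.cases ?_ (fun j => ?_) j
      · exact fun _ => rfl
      · exact fun h => absurd h.symm (Fin.succ_ne_zero _)
      · exact fun h => absurd h (Fin.succ_ne_zero _)
      · exact fun h => congrArg Fin.succ (hinj (Fin.succ_injective _ h))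
  | swap a b l =>
    refine ⟨Equiv.swap (0 : Fin (l.length + 2)) 1, ?_, (Equiv.swap _ _).injective⟩
    intro i
    refine Fin.cases ?_ (fun j => Fin.cases ?_ (fun k => ?_) j) i
    · rw [Equiv.swap_apply_left]; rfl
    · rw [Fin.succ_zero_eq_one, Equiv.swap_apply_right]; rfl
    · rw [Equiv.swap_apply_of_ne_of_ne]
      · rfl
      · exact Fin.succ_ne_zero _
      · rw [← Fin.succ_zero_eq_one]
        exact fun h => Fin.succ_ne_zero _ (Fin.succ_injective _ h)
  | trans _ _ ih₁ ih₂ =>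
    obtain ⟨m₁, hm₁, hi₁⟩ := ih₁
    obtain ⟨m₂, hm₂, hi₂⟩ := ih₂
    exact ⟨m₂ ∘ m₁, fun i => (hm₁ i).trans (hm₂ _), hi₂.comp hi₁⟩

theorem List.map_perm_map_of_bijective {l l' : List α} (g : α → β)
    {m : Fin l.length → Fin l'.length} (hm : Function.Bijective m)
    (h : ∀ i, g (l.get i) = g (l'.get (m i))) : (l.map g).Perm (l'.map g) := by
  have e : ∀ l : List α, l.map g = (List.finRange l.length).map fun i => g (l.get i) := by
    intro l
    conv_lhs => rw [← List.map_get_finRange l, List.map_map]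
    rfl
  rw [e l, e l']
  have hp : ((List.finRange l.length).map m).Perm (List.finRange l'.length) := by
    rw [List.perm_ext_iff_of_nodup ((List.nodup_finRange _).map hm.1) (List.nodup_finRange _)]
    intro j
    simpa using hm.2 j
  have := hp.map fun i => g (l'.get i)
  rw [List.map_map] at this
  simpa only [Function.comp_def, h] using this

end Order

/-! ### Subsumption and order of a bounded language -/

section Canon

variable {S : FirstOrder.Language.{u, v}} {V : Type w} {U : Type x} {X Y : Finset V}

namespace BLang

variable {L : BLang S V}

theorem sub_bigAnd_iff {l l' : List (Fml S V)} :
    (BLang.bigAnd L).Sub (.bigAnd l) (.bigAnd l') ↔ ∀ ψ ∈ l', ∃ φ ∈ l, L.Sub φ ψ := by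
  rw [Sub]
  constructor
  · rintro ⟨m, hm⟩ ψ hψ
    obtain ⟨i, rfl⟩ := List.mem_iff_get.1 hψ
    exact ⟨_, List.get_mem _ _, hm i⟩
  · intro h
    have : ∀ i : Fin l'.length, ∃ j : Fin l.length, L.Sub (l.get j) (l'.get i) := by
      intro i
      obtain ⟨φ, hφ, hs⟩ := h _ (List.get_mem l' i)
      obtain ⟨j, rfl⟩ := List.mem_iff_get.1 hφ
      exact ⟨j, hs⟩
    choose m hm using this
    exact ⟨m, hm⟩

theorem sub_refl {φ : Fml S V} (hφ : φ ∈ L.formulas) : L.Sub φ φ := by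
  induction L generalizing φ with
  | base B =>
    obtain ⟨f, -, rfl⟩ := hφ
    exact Or.inr rfl
  | or L₁ L₂ ih₁ ih₂ =>
    obtain ⟨φ₁, h₁, φ₂, h₂, rfl⟩ := hφ
    exact ⟨ih₁ h₁, ih₂ h₂⟩
  | and L₁ L₂ ih₁ ih₂ =>
    obtain ⟨φ₁, h₁, φ₂, h₂, rfl⟩ := hφ
    exact ⟨ih₁ h₁, ih₂ h₂⟩
  | bigOr k L ih =>
    obtain ⟨l, hl, -, rfl⟩ := hφ
    exact ⟨id, fun i => ih (hl _ (List.get_mem _ _)), fun _ _ h => h⟩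
  | bigAnd L ih =>
    obtain ⟨l, hl, -, rfl⟩ := hφ
    exact sub_bigAnd_iff.2 fun ψ hψ => ⟨ψ, hψ, ih (hl ψ hψ)⟩
  | quant q Y L ih =>
    obtain ⟨ψ, hψ, rfl⟩ := hφ
    exact ⟨1, one_mem_permsOn, by rw [subst_one]; exact ih hψ⟩
  | quantAny Y L ih =>
    obtain ⟨q, ψ, hψ, rfl⟩ := hφ
    exact ⟨⟨1, one_mem_permsOn, by rw [subst_one]; exact ih hψ⟩, by cases q <;> simp⟩

theorem sub_subst {π : Equiv.Perm V} (hπ : π ∈ permsOn X) (hc : L.CaptureFree)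
    (hL : L.NoCapture X) {φ ψ : Fml S V} (hφ : φ ∈ L.formulas) (hψ : ψ ∈ L.formulas)
    (h : L.Sub φ ψ) : L.Sub (φ.subst π) (ψ.subst π) := by
  induction L generalizing φ ψ with
  | base B =>
    obtain ⟨f, -, rfl⟩ := hφ
    obtain ⟨g, -, rfl⟩ := hψ
    simp only [Fml.subst]
    rcases h with rfl | rfl
    · exact Or.inl rfl
    · exact Or.inr rfl
  | or L₁ L₂ ih₁ ih₂ =>
    obtain ⟨φ₁, h₁, φ₂, h₂, rfl⟩ := hφ
    obtain ⟨ψ₁, h₁', ψ₂, h₂', rfl⟩ := hψ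
    simp only [Fml.subst]
    exact ⟨ih₁ hc.1 hL.1 h₁ h₁' h.1, ih₂ hc.2 hL.2 h₂ h₂' h.2⟩
  | and L₁ L₂ ih₁ ih₂ =>
    obtain ⟨φ₁, h₁, φ₂, h₂, rfl⟩ := hφ
    obtain ⟨ψ₁, h₁', ψ₂, h₂', rfl⟩ := hψ
    simp only [Fml.subst]
    exact ⟨ih₁ hc.1 hL.1 h₁ h₁' h.1, ih₂ hc.2 hL.2 h₂ h₂' h.2⟩
  | bigOr k L ih =>
    obtain ⟨l, hl, -, rfl⟩ := hφ
    obtain ⟨l', hl', -, rfl⟩ := hψ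
    obtain ⟨m, hm, hinj⟩ := h
    simp only [Fml.subst]
    refine ⟨fun i => (m (i.cast (List.length_map _))).cast (List.length_map _).symm, ?_, ?_⟩
    · intro i
      simpa using ih hc hL (hl _ (List.get_mem _ _)) (hl' _ (List.get_mem _ _))
        (hm (i.cast (List.length_map _)))
    · intro i j hij
      simpa using hinj (Fin.cast_injective _ hij)
  | bigAnd L ih =>
    obtain ⟨l, hl, -, rfl⟩ := hφ
    obtain ⟨l', hl', -, rfl⟩ := hψ
    simp only [Fml.subst]
    rw [sub_bigAnd_iff] at h ⊢
    rw [List.forall_mem_map]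
    intro ψ hψ
    obtain ⟨φ, hφ, hs⟩ := h ψ hψ
    exact ⟨_, List.mem_map_of_mem hφ, ih hc hL (hl φ hφ) (hl' ψ hψ) hs⟩
  | quant q Y L ih =>
    obtain ⟨φ, hφ, rfl⟩ := hφ
    obtain ⟨ψ, hψ, rfl⟩ := hψ
    rcases hL with hL | ⟨hd, hL⟩
    · simpa only [subst_quant_of_subset hπ hL, subst_id] using h
    · obtain ⟨ρ, hρ, hs⟩ := h
      simp only [subst_quant_of_disjoint hπ hd]
      refine ⟨ρ, hρ, ?_⟩
      rw [subst_subst_comm hπ hρ hd hL hc.2 hψ]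
      exact ih hc.1 hL hφ (subst_mem hρ hc.2 hψ) hs
  | quantAny Y L ih =>
    obtain ⟨q, φ, hφ, rfl⟩ := hφ
    obtain ⟨q', ψ, hψ, rfl⟩ := hψ
    rcases hL with hL | ⟨hd, hL⟩
    · simpa only [subst_quant_of_subset hπ hL, subst_id] using h
    · obtain ⟨⟨ρ, hρ, hs⟩, hq⟩ := h
      simp only [subst_quant_of_disjoint hπ hd]
      refine ⟨⟨ρ, hρ, ?_⟩, hq⟩
      rw [subst_subst_comm hπ hρ hd hL hc.2 hψ]
      exact ih hc.1 hL hφ (subst_mem hρ hc.2 hψ) hs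

/-- Subsumption up to a permutation composes, provided that `L.Sub` is transitive at the formulas
that occur. -/
theorem exists_perm_sub_trans (hc : L.CaptureFree) (hL : L.NoCapture X) {φ ψ χ : Fml S V}
    (hψ : ψ ∈ L.formulas) (hχ : χ ∈ L.formulas)
    (ht : ∀ ψ ∈ L.formulas, ∀ χ ∈ L.formulas, L.Sub φ ψ → L.Sub ψ χ → L.Sub φ χ)
    (h : ∃ π ∈ permsOn X, L.Sub φ (ψ.subst π)) (h' : ∃ π ∈ permsOn X, L.Sub ψ (χ.subst π)) :
    ∃ π ∈ permsOn X, L.Sub φ (χ.subst π) := by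
  obtain ⟨π, hπ, h⟩ := h
  obtain ⟨ρ, hρ, h'⟩ := h'
  refine ⟨π * ρ, mul_mem_permsOn hπ hρ, ?_⟩
  rw [← subst_subst hρ hπ hL hχ]
  have hχ' := subst_mem hρ hL hχ
  exact ht _ (subst_mem hπ hL hψ) _ (subst_mem hπ hL hχ') h (sub_subst hπ hc hL hψ hχ' h')

theorem sub_trans (hc : L.CaptureFree) {φ ψ χ : Fml S V} (hφ : φ ∈ L.formulas)
    (hψ : ψ ∈ L.formulas) (hχ : χ ∈ L.formulas) (h : L.Sub φ ψ) (h' : L.Sub ψ χ) :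
    L.Sub φ χ := by
  induction L generalizing φ ψ χ with
  | base B =>
    obtain ⟨f, -, rfl⟩ := hφ
    obtain ⟨g, -, rfl⟩ := hψ
    obtain ⟨e, -, rfl⟩ := hχ
    rcases h with rfl | rfl
    · exact Or.inl rfl
    · exact h'
  | or L₁ L₂ ih₁ ih₂ =>
    obtain ⟨φ₁, h₁, φ₂, h₂, rfl⟩ := hφ
    obtain ⟨ψ₁, h₁', ψ₂, h₂', rfl⟩ := hψ
    obtain ⟨χ₁, h₁'', χ₂, h₂'', rfl⟩ := hχ
    exact ⟨ih₁ hc.1 h₁ h₁' h₁'' h.1 h'.1, ih₂ hc.2 h₂ h₂' h₂'' h.2 h'.2⟩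
  | and L₁ L₂ ih₁ ih₂ =>
    obtain ⟨φ₁, h₁, φ₂, h₂, rfl⟩ := hφ
    obtain ⟨ψ₁, h₁', ψ₂, h₂', rfl⟩ := hψ
    obtain ⟨χ₁, h₁'', χ₂, h₂'', rfl⟩ := hχ
    exact ⟨ih₁ hc.1 h₁ h₁' h₁'' h.1 h'.1, ih₂ hc.2 h₂ h₂' h₂'' h.2 h'.2⟩
  | bigOr k L ih =>
    obtain ⟨l, hl, -, rfl⟩ := hφ
    obtain ⟨l', hl', -, rfl⟩ := hψ
    obtain ⟨l'', hl'', -, rfl⟩ := hχ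
    obtain ⟨m, hm, hinj⟩ := h
    obtain ⟨m', hm', hinj'⟩ := h'
    exact ⟨m' ∘ m, fun i => ih hc (hl _ (List.get_mem _ _)) (hl' _ (List.get_mem _ _))
      (hl'' _ (List.get_mem _ _)) (hm i) (hm' _), hinj'.comp hinj⟩
  | bigAnd L ih =>
    obtain ⟨l, hl, -, rfl⟩ := hφ
    obtain ⟨l', hl', -, rfl⟩ := hψ
    obtain ⟨l'', hl'', -, rfl⟩ := hχ
    rw [sub_bigAnd_iff] at h h' ⊢
    intro χ hχ
    obtain ⟨ψ, hψ, hs'⟩ := h' χ hχ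
    obtain ⟨φ, hφ, hs⟩ := h ψ hψ
    exact ⟨φ, hφ, ih hc (hl _ hφ) (hl' _ hψ) (hl'' _ hχ) hs hs'⟩
  | quant q Y L ih =>
    obtain ⟨φ, hφ, rfl⟩ := hφ
    obtain ⟨ψ, hψ, rfl⟩ := hψ
    obtain ⟨χ, hχ, rfl⟩ := hχ
    exact exists_perm_sub_trans hc.1 hc.2 hψ hχ
      (fun ψ hψ χ hχ hs hs' => ih hc.1 hφ hψ hχ hs hs') h h'
  | quantAny Y L ih =>
    obtain ⟨q, φ, hφ, rfl⟩ := hφ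
    obtain ⟨q', ψ, hψ, rfl⟩ := hψ
    obtain ⟨q'', χ, hχ, rfl⟩ := hχ
    refine ⟨exists_perm_sub_trans hc.1 hc.2 hψ hχ
      (fun ψ hψ χ hχ hs hs' => ih hc.1 hφ hψ hχ hs hs') h.1 h'.1, ?_⟩
    have h2 := h.2
    have h2' := h'.2
    cases q <;> cases q' <;> cases q'' <;> simp_all

theorem bot_mem (L : BLang S V) : L.bot ∈ L.formulas := by
  induction L with
  | base B => exact ⟨⊥, Or.inl rfl, rfl⟩
  | or L₁ L₂ ih₁ ih₂ => exact ⟨_, ih₁, _, ih₂, rfl⟩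
  | and L₁ L₂ ih₁ ih₂ => exact ⟨_, ih₁, _, ih₂, rfl⟩
  | bigOr k L ih => exact ⟨[], by simp, by simp, rfl⟩
  | bigAnd L ih => exact ⟨[L.bot], by simpa using ih, by simp, rfl⟩
  | quant q Y L ih => exact ⟨_, ih, rfl⟩
  | quantAny Y L ih => exact ⟨_, _, ih, rfl⟩

theorem bot_sub {φ : Fml S V} (hφ : φ ∈ L.formulas) : L.Sub L.bot φ := by
  induction L generalizing φ with
  | base B =>
    obtain ⟨f, -, rfl⟩ := hφ
    exact Or.inl rfl
  | or L₁ L₂ ih₁ ih₂ =>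
    obtain ⟨φ₁, h₁, φ₂, h₂, rfl⟩ := hφ
    exact ⟨ih₁ h₁, ih₂ h₂⟩
  | and L₁ L₂ ih₁ ih₂ =>
    obtain ⟨φ₁, h₁, φ₂, h₂, rfl⟩ := hφ
    exact ⟨ih₁ h₁, ih₂ h₂⟩
  | bigOr k L ih =>
    obtain ⟨l, hl, -, rfl⟩ := hφ
    exact ⟨fun i => i.elim0, fun i => i.elim0, fun i => i.elim0⟩
  | bigAnd L ih =>
    obtain ⟨l, hl, -, rfl⟩ := hφ
    exact sub_bigAnd_iff.2 fun ψ hψ => ⟨L.bot, by simp, ih (hl ψ hψ)⟩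
  | quant q Y L ih =>
    obtain ⟨ψ, hψ, rfl⟩ := hφ
    exact ⟨1, one_mem_permsOn, by rw [subst_one]; exact ih hψ⟩
  | quantAny Y L ih =>
    obtain ⟨q, ψ, hψ, rfl⟩ := hφ
    exact ⟨⟨1, one_mem_permsOn, by rw [subst_one]; exact ih hψ⟩, Or.inl rfl⟩

/-- Subsumption is sound for entailment. -/
theorem sat_of_sub [S.Structure U] (hc : L.CaptureFree) {φ ψ : Fml S V} (hφ : φ ∈ L.formulas)
    (hψ : ψ ∈ L.formulas) (h : L.Sub φ ψ) {μ : V → U} (hs : φ.Sat μ) : ψ.Sat μ := by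
  induction L generalizing φ ψ μ with
  | base B =>
    obtain ⟨f, -, rfl⟩ := hφ
    obtain ⟨g, -, rfl⟩ := hψ
    rcases h with rfl | rfl
    · simp only [Fml.Sat] at hs
      exact hs.elim
    · exact hs
  | or L₁ L₂ ih₁ ih₂ =>
    obtain ⟨φ₁, h₁, φ₂, h₂, rfl⟩ := hφ
    obtain ⟨ψ₁, h₁', ψ₂, h₂', rfl⟩ := hψ
    rw [Fml.Sat] at hs ⊢
    exact hs.imp (ih₁ hc.1 h₁ h₁' h.1) (ih₂ hc.2 h₂ h₂' h.2)
  | and L₁ L₂ ih₁ ih₂ =>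
    obtain ⟨φ₁, h₁, φ₂, h₂, rfl⟩ := hφ
    obtain ⟨ψ₁, h₁', ψ₂, h₂', rfl⟩ := hψ
    rw [Fml.Sat] at hs ⊢
    exact hs.imp (ih₁ hc.1 h₁ h₁' h.1) (ih₂ hc.2 h₂ h₂' h.2)
  | bigOr k L ih =>
    obtain ⟨l, hl, -, rfl⟩ := hφ
    obtain ⟨l', hl', -, rfl⟩ := hψ
    obtain ⟨m, hm, -⟩ := h
    rw [Fml.Sat] at hs ⊢
    obtain ⟨φ, hφ, hs⟩ := hs
    obtain ⟨i, rfl⟩ := List.mem_iff_get.1 hφ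
    exact ⟨_, List.get_mem _ _, ih hc (hl _ hφ) (hl' _ (List.get_mem _ _)) (hm i) hs⟩
  | bigAnd L ih =>
    obtain ⟨l, hl, -, rfl⟩ := hφ
    obtain ⟨l', hl', -, rfl⟩ := hψ
    rw [sub_bigAnd_iff] at h
    rw [Fml.Sat] at hs ⊢
    intro ψ hψ
    obtain ⟨φ, hφ, hs'⟩ := h ψ hψ
    exact ih hc (hl _ hφ) (hl' _ hψ) hs' (hs φ hφ)
  | quant q Y L ih =>
    obtain ⟨φ, hφ, rfl⟩ := hφ
    obtain ⟨ψ, hψ, rfl⟩ := hψ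
    obtain ⟨π, hπ, h⟩ := h
    have key : ∀ μ : V → U, φ.Sat μ → ψ.Sat (μ ∘ π) := fun μ hs =>
      (sat_subst hπ hc.2 hψ μ).1 (ih hc.1 hφ (subst_mem hπ hc.2 hψ) h hs)
    cases q with
    | ex =>
      rw [Fml.Sat] at hs ⊢
      obtain ⟨ν, hs⟩ := hs
      obtain ⟨ν', hν'⟩ := updateOn_comp_perm hπ μ ν
      exact ⟨ν', hν' ▸ key _ hs⟩
    | all =>
      rw [Fml.Sat] at hs ⊢
      intro ν
      obtain ⟨ν', hν'⟩ := updateOn_comp_perm (inv_mem_permsOn hπ) μ ν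
      have := key _ (hs ν')
      rwa [← hν', Function.comp_assoc, ← Equiv.Perm.coe_mul, inv_mul_cancel] at this
  | quantAny Y L ih =>
    obtain ⟨q, φ, hφ, rfl⟩ := hφ
    obtain ⟨q', ψ, hψ, rfl⟩ := hψ
    obtain ⟨⟨π, hπ, h⟩, hq⟩ := h
    have key : ∀ μ : V → U, φ.Sat μ → ψ.Sat (μ ∘ π) := fun μ hs =>
      (sat_subst hπ hc.2 hψ μ).1 (ih hc.1 hφ (subst_mem hπ hc.2 hψ) h hs)
    cases q' with
    | ex =>
      have hex : ∃ ν : Y → U, φ.Sat (updateOn μ ν) := by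
        cases q with
        | ex => rwa [Fml.Sat] at hs
        | all =>
          rw [Fml.Sat] at hs
          exact ⟨_, hs fun a => μ a⟩
      rw [Fml.Sat]
      obtain ⟨ν, hs⟩ := hex
      obtain ⟨ν', hν'⟩ := updateOn_comp_perm hπ μ ν
      exact ⟨ν', hν' ▸ key _ hs⟩
    | all =>
      obtain rfl : q = .all := by simpa using hq
      rw [Fml.Sat] at hs ⊢
      intro ν
      obtain ⟨ν', hν'⟩ := updateOn_comp_perm (inv_mem_permsOn hπ) μ ν
      have := key _ (hs ν')
      rwa [← hν', Function.comp_assoc, ← Equiv.Perm.coe_mul, inv_mul_cancel] at this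

theorem le_isLinearOrderOn (L : BLang S V) : IsLinearOrderOn L.le L.formulas := by
  induction L with
  | base B =>
    refine IsLinearOrderOn.of_subset_image
      ⟨B.le_total, B.le_trans, B.le_antisymm⟩ (Fml.atom : S.Formula V → Fml S V) ?_ ?_
    · rintro _ ⟨f, hf, rfl⟩
      exact ⟨f, hf, rfl⟩
    · exact fun _ _ _ _ => Iff.rfl
  | or L₁ L₂ ih₁ ih₂ =>
    refine (ih₁.prod ih₂).of_subset_image (fun p => Fml.or p.1 p.2) ?_ ?_
    · rintro _ ⟨φ₁, h₁, φ₂, h₂, rfl⟩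
      exact ⟨(φ₁, φ₂), ⟨h₁, h₂⟩, rfl⟩
    · exact fun _ _ _ _ => Iff.rfl
  | and L₁ L₂ ih₁ ih₂ =>
    refine (ih₁.prod ih₂).of_subset_image (fun p => Fml.and p.1 p.2) ?_ ?_
    · rintro _ ⟨φ₁, h₁, φ₂, h₂, rfl⟩
      exact ⟨(φ₁, φ₂), ⟨h₁, h₂⟩, rfl⟩
    · exact fun _ _ _ _ => Iff.rfl
  | bigOr k L ih =>
    -- Reversing both the sequences and the order turns suffixes into the extensions that are
    -- smaller in `PrefixLex`.
    refine ih.flip.prefixLex.flip.of_subset_image (fun l => Fml.bigOr l.reverse) ?_ ?_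
    · rintro _ ⟨l, hl, -, rfl⟩
      exact ⟨l.reverse, by simpa using hl, by simp⟩
    · intro l _ l' _
      simp only [le, _root_.flip, PrefixLex, LexDiff]
      refine or_congr List.reverse_suffix ?_
      constructor
      · rintro ⟨p, p', t, a, b, h, h', hab, hne⟩
        refine ⟨t.reverse, p'.reverse, p.reverse, b, a, ?_, ?_, hab, hne.symm⟩
        · simpa using congrArg List.reverse h'
        · simpa using congrArg List.reverse h
      · rintro ⟨p, t, t', b, a, rfl, rfl, hab, hne⟩
        exact ⟨t'.reverse, t.reverse, p.reverse, a, b, by simp, by simp, hab, hne.symm⟩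
  | bigAnd L ih =>
    refine ih.prefixLex.of_subset_image Fml.bigAnd ?_ ?_
    · rintro _ ⟨l, hl, -, rfl⟩
      exact ⟨l, hl, rfl⟩
    · exact fun _ _ _ _ => Iff.rfl
  | quant q Y L ih =>
    refine ih.of_subset_image (Fml.quant q Y) ?_ ?_
    · rintro _ ⟨ψ, hψ, rfl⟩
      exact ⟨ψ, hψ, rfl⟩
    · exact fun _ _ _ _ => Iff.rfl
  | quantAny Y L ih =>
    have hq : IsLinearOrderOn (fun q q' : Quant => q = q' ∨ (q = .all ∧ q' = .ex)) Set.univ := by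
      refine ⟨?_, ?_, ?_⟩
      · rintro (_ | _) - (_ | _) - <;> simp
      · rintro (_ | _) - (_ | _) - (_ | _) - <;> simp
      · rintro (_ | _) - (_ | _) - <;> simp
    refine (hq.prod ih).of_subset_image (fun p => Fml.quant p.1 Y p.2) ?_ ?_
    · rintro _ ⟨q, ψ, hψ, rfl⟩
      exact ⟨(q, ψ), ⟨trivial, hψ⟩, rfl⟩
    · rintro ⟨(_ | _), φ⟩ - ⟨(_ | _), ψ⟩ - <;> simp [le]

end BLang

end Canon

/-! ### Minimal elements under subsumption -/

section Canon

variable {S : FirstOrder.Language.{u, v}} {V : Type w} {U : Type x} {X Y : Finset V}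

namespace BLang

variable {L : BLang S V}

theorem exists_minSub_sub_of_antisymm (hc : L.CaptureFree) {F : Set (Fml S V)} (hF : F.Finite)
    (hFL : F ⊆ L.formulas) (ha : ∀ φ ∈ F, ∀ ψ ∈ F, L.Sub φ ψ → L.Sub ψ φ → φ = ψ)
    {φ : Fml S V} (hφ : φ ∈ F) : ∃ ψ ∈ L.minSub F, L.Sub ψ φ := by
  let _ : PartialOrder F :=
    { le := fun a b => L.Sub a b
      le_refl := fun a => sub_refl (hFL a.2)
      le_trans := fun a b c => sub_trans hc (hFL a.2) (hFL b.2) (hFL c.2)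
      le_antisymm := fun a b h h' => Subtype.ext (ha a a.2 b b.2 h h') }
  have : Finite F := hF
  obtain ⟨m, hm, hmin⟩ := exists_minimal_le_of_wellFoundedLT (fun _ : F => True) ⟨φ, hφ⟩ trivial
  refine ⟨m, ⟨m.2, fun ψ hψ hne hs => hne ?_⟩, hm⟩
  exact ha ψ hψ m m.2 hs (hmin.2 (y := ⟨ψ, hψ⟩) trivial hs)

theorem minSub_subset (L : BLang S V) (F : Set (Fml S V)) : L.minSub F ⊆ F := fun _ h => h.1

/-- A subset that contains a lower bound of every element has the same minimal elements. -/
theorem minSub_eq_of_dominates (hc : L.CaptureFree) {F G : Set (Fml S V)} (hFG : F ⊆ G)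
    (hG : G ⊆ L.formulas) (ha : ∀ φ ∈ G, ∀ ψ ∈ G, L.Sub φ ψ → L.Sub ψ φ → φ = ψ)
    (hd : ∀ ψ ∈ G, ∃ φ ∈ F, L.Sub φ ψ) : L.minSub G = L.minSub F := by
  ext φ
  constructor
  · rintro ⟨hφ, hmin⟩
    obtain ⟨χ, hχ, hs⟩ := hd φ hφ
    have : χ = φ := by
      by_contra hne
      exact hmin χ (hFG hχ) hne hs
    exact ⟨this ▸ hχ, fun ψ hψ => hmin ψ (hFG hψ)⟩
  · rintro ⟨hφ, hmin⟩
    refine ⟨hFG hφ, fun ψ hψ hne hs => hne ?_⟩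
    obtain ⟨χ, hχ, hs'⟩ := hd ψ hψ
    have hs'' := sub_trans hc (hG (hFG hχ)) (hG hψ) (hG (hFG hφ)) hs' hs
    have : χ = φ := by
      by_contra hne'
      exact hmin χ hχ hne' hs''
    exact ha ψ hψ φ (hFG hφ) hs (this ▸ hs')

/-! ### Sorted sequences -/

open scoped Classical in
theorem sort_perm (L : BLang S V) (l : List (Fml S V)) : (L.sort l).Perm l := by
  rw [sort]
  exact List.perm_insertionSort _ _

theorem mem_sort {l : List (Fml S V)} {φ : Fml S V} : φ ∈ L.sort l ↔ φ ∈ l :=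
  (sort_perm L l).mem_iff

theorem sort_eq_of_perm {l l' : List (Fml S V)} (hl : ∀ φ ∈ l, φ ∈ L.formulas)
    (h : l.Perm l') : L.sort l = L.sort l' :=
  (le_isLinearOrderOn L).insertionSort_eq_of_perm hl h

theorem mem_sortSet {F : Set (Fml S V)} (hF : F.Finite) {φ : Fml S V} :
    φ ∈ L.sortSet F ↔ φ ∈ F := by
  rw [sortSet, dif_pos hF, mem_sort]
  simp

theorem setOf_mem_map_canon_eq {l : List (Fml S V)} :
    {ψ | ∃ φ ∈ l, ψ = L.canon φ} = {ψ | ψ ∈ l.map L.canon} := by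
  ext ψ
  simp [eq_comm]

theorem canon_images_finite (L : BLang S V) (l : List (Fml S V)) :
    {ψ | ∃ φ ∈ l, ψ = L.canon φ}.Finite := by
  rw [setOf_mem_map_canon_eq]
  exact List.finite_toSet _

theorem mem_sortSet_minSub {l : List (Fml S V)} {χ : Fml S V} :
    χ ∈ L.sortSet (L.minSub {ψ | ∃ φ ∈ l, ψ = L.canon φ}) ↔
      χ ∈ L.minSub {ψ | ∃ φ ∈ l, ψ = L.canon φ} :=
  mem_sortSet ((canon_images_finite L l).subset (minSub_subset _ _))

/-! ### Canonicalization selects representatives -/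

/-- Canonicalization stays in the language and sends every formula to a formula that is equivalent
under mutual subsumption, the same one for equivalent formulas. -/
structure CanonRepresents (L : BLang S V) : Prop where
  mem : ∀ {φ}, φ ∈ L.formulas → L.canon φ ∈ L.formulas
  sub_canon : ∀ {φ}, φ ∈ L.formulas → L.Sub φ (L.canon φ)
  canon_sub : ∀ {φ}, φ ∈ L.formulas → L.Sub (L.canon φ) φ
  congr : ∀ {φ ψ}, φ ∈ L.formulas → ψ ∈ L.formulas → L.Sub φ ψ → L.Sub ψ φ →
    L.canon φ = L.canon ψ

theorem CanonRepresents.canon_canon (h : L.CanonRepresents) {φ : Fml S V}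
    (hφ : φ ∈ L.formulas) : L.canon (L.canon φ) = L.canon φ :=
  h.congr (h.mem hφ) hφ (h.canon_sub hφ) (h.sub_canon hφ)

/-- The canonical formulas of the permuted variants of `φ`. -/
def canonOrbit (L : BLang S V) (X : Finset V) (φ : Fml S V) : Set (Fml S V) :=
  {ψ | ∃ π ∈ permsOn X, ψ = L.canon (φ.subst π)}

theorem canonOrbit_finite (L : BLang S V) (X : Finset V) (φ : Fml S V) :
    (L.canonOrbit X φ).Finite := by
  refine ((permsOn_finite X).image fun π : Equiv.Perm V => L.canon (φ.subst π)).subset ?_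
  rintro _ ⟨π, hπ, rfl⟩
  exact ⟨π, hπ, rfl⟩

namespace CanonRepresents

theorem minLe_mem (h : L.CanonRepresents) (hL : L.NoCapture X) {φ : Fml S V}
    (hφ : φ ∈ L.formulas) : L.minLe (L.canonOrbit X φ) ∈ L.canonOrbit X φ := by
  have hex : ∃ ψ ∈ L.canonOrbit X φ, ∀ χ ∈ L.canonOrbit X φ, L.le ψ χ := by
    refine (le_isLinearOrderOn L).exists_least (canonOrbit_finite L X φ)
      ⟨_, 1, one_mem_permsOn, rfl⟩ ?_
    rintro _ ⟨π, hπ, rfl⟩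
    exact h.mem (subst_mem hπ hL hφ)
  rw [minLe, dif_pos hex]
  exact hex.choose_spec.1

theorem canonOrbit_subset (h : L.CanonRepresents) (hc : L.CaptureFree) (hL : L.NoCapture X)
    {φ ψ : Fml S V} (hφ : φ ∈ L.formulas) (hψ : ψ ∈ L.formulas)
    (h₁ : ∃ π ∈ permsOn X, L.Sub φ (ψ.subst π)) (h₂ : ∃ π ∈ permsOn X, L.Sub ψ (φ.subst π)) :
    L.canonOrbit X φ ⊆ L.canonOrbit X ψ := by
  obtain ⟨π, hπ, h₁⟩ := h₁
  obtain ⟨ρ, hρ, h₂⟩ := h₂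
  have hψπ := subst_mem hπ hL hψ
  have hτ := mul_mem_permsOn hπ hρ
  have h₃ : L.Sub (ψ.subst π) (φ.subst (π * ρ : Equiv.Perm V)) := by
    rw [← subst_subst hρ hπ hL hφ]
    exact sub_subst hπ hc hL hψ (subst_mem hρ hL hφ) h₂
  have h₄ := sub_trans hc hφ hψπ (subst_mem hτ hL hφ) h₁ h₃
  -- `φ` subsumes a permutation of itself, hence is equivalent to it as permutations have finite
  -- order.
  have h₅ : L.Sub (φ.subst (π * ρ : Equiv.Perm V)) φ := by
    have : Finite (permsOn X) := permsOn_finite X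
    have := rel_of_injective_of_finite (α := permsOn X)
      (r := fun a b => L.Sub (φ.subst a.1) (φ.subst b.1))
      (fun a => sub_refl (subst_mem a.2 hL hφ))
      (fun a b c => sub_trans hc (subst_mem a.2 hL hφ) (subst_mem b.2 hL hφ)
        (subst_mem c.2 hL hφ))
      (f := fun a => ⟨a.1 * (π * ρ), mul_mem_permsOn a.2 hτ⟩)
      (fun a b hab => Subtype.ext (mul_right_cancel (congrArg Subtype.val hab)))
      (fun a => by
        rw [← subst_subst hτ a.2 hL hφ]
        exact sub_subst a.2 hc hL hφ (subst_mem hτ hL hφ) h₄)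
      ⟨1, one_mem_permsOn⟩
    simpa only [one_mul, subst_one] using this
  have h₆ := sub_trans hc hψπ (subst_mem hτ hL hφ) hφ h₃ h₅
  rintro _ ⟨σ, hσ, rfl⟩
  refine ⟨σ * π, mul_mem_permsOn hσ hπ, ?_⟩
  rw [← subst_subst hπ hσ hL hψ]
  exact h.congr (subst_mem hσ hL hφ) (subst_mem hσ hL hψπ)
    (sub_subst hσ hc hL hφ hψπ h₁) (sub_subst hσ hc hL hψπ hφ h₆)

theorem canonOrbit_eq (h : L.CanonRepresents) (hc : L.CaptureFree) (hL : L.NoCapture X)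
    {φ ψ : Fml S V} (hφ : φ ∈ L.formulas) (hψ : ψ ∈ L.formulas)
    (h₁ : ∃ π ∈ permsOn X, L.Sub φ (ψ.subst π)) (h₂ : ∃ π ∈ permsOn X, L.Sub ψ (φ.subst π)) :
    L.canonOrbit X φ = L.canonOrbit X ψ :=
  (h.canonOrbit_subset hc hL hφ hψ h₁ h₂).antisymm (h.canonOrbit_subset hc hL hψ hφ h₂ h₁)

theorem minLe_spec (h : L.CanonRepresents) (hc : L.CaptureFree) (hL : L.NoCapture X)
    {φ : Fml S V} (hφ : φ ∈ L.formulas) :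
    L.minLe (L.canonOrbit X φ) ∈ L.formulas ∧
      (∃ π ∈ permsOn X, L.Sub φ ((L.minLe (L.canonOrbit X φ)).subst π)) ∧
      ∃ π ∈ permsOn X, L.Sub (L.minLe (L.canonOrbit X φ)) (φ.subst π) := by
  obtain ⟨π, hπ, he⟩ := h.minLe_mem hL hφ
  have hφπ := subst_mem hπ hL hφ
  rw [he]
  refine ⟨h.mem hφπ, ⟨π⁻¹, inv_mem_permsOn hπ, ?_⟩, π, hπ, h.canon_sub hφπ⟩
  have := sub_subst (inv_mem_permsOn hπ) hc hL hφπ (h.mem hφπ) (h.sub_canon hφπ)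
  rwa [subst_inv_subst hπ hL hφ] at this

theorem bigOr (h : L.CanonRepresents) (hc : L.CaptureFree) (k : ℕ) :
    (BLang.bigOr k L).CanonRepresents where
  mem := by
    rintro _ ⟨l, hl, hk, rfl⟩
    refine ⟨_, fun φ hφ => ?_, by rwa [(sort_perm L _).length_eq, List.length_map], rfl⟩
    rw [mem_sort] at hφ
    obtain ⟨ψ, hψ, rfl⟩ := List.mem_map.1 hφ
    exact h.mem (hl ψ hψ)
  sub_canon := by
    rintro _ ⟨l, hl, hk, rfl⟩
    obtain ⟨m, hm, hinj⟩ := (sort_perm L (l.map L.canon)).symm.exists_injective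
    refine ⟨fun i => m (i.cast (List.length_map _).symm), fun i => ?_, fun i j hij => ?_⟩
    · rw [← hm]
      simpa using h.sub_canon (hl _ (List.get_mem l i))
    · simpa using hinj hij
  canon_sub := by
    rintro _ ⟨l, hl, hk, rfl⟩
    obtain ⟨m, hm, hinj⟩ := (sort_perm L (l.map L.canon)).exists_injective
    refine ⟨fun i => (m i).cast (List.length_map _), fun i => ?_, fun i j hij => ?_⟩
    · rw [hm]
      simpa using h.canon_sub (hl _ (List.get_mem l ((m i).cast (List.length_map _))))
    · exact hinj (Fin.cast_injective _ hij)
  congr := by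
    rintro _ _ ⟨l, hl, hk, rfl⟩ ⟨l', hl', hk', rfl⟩ ⟨m, hm, hinj⟩ ⟨m', hm', hinj'⟩
    simp only [canon]
    congr 1
    refine sort_eq_of_perm ?_ (List.map_perm_map_of_bijective (m := m) _ ?_ fun i => ?_)
    · rw [List.forall_mem_map]
      exact fun φ hφ => h.mem (hl φ hφ)
    · have h1 := Fintype.card_le_of_injective m hinj
      have h2 := Fintype.card_le_of_injective m' hinj'
      exact (Fintype.bijective_iff_injective_and_card m).2 ⟨hinj, h1.antisymm h2⟩
    · have hl := fun i => hl _ (List.get_mem l i)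
      have hl' := fun i => hl' _ (List.get_mem l' i)
      refine h.congr (hl _) (hl' _) (hm i) ?_
      have := rel_of_injective_of_finite (r := fun i j => L.Sub (l.get i) (l.get j))
        (fun i => sub_refl (hl i)) (fun i j k => sub_trans hc (hl i) (hl j) (hl k))
        (hinj'.comp hinj) (fun i => sub_trans hc (hl i) (hl' _) (hl _) (hm i) (hm' _)) i
      exact sub_trans hc (hl' _) (hl _) (hl _) (hm' _) this

theorem bigAnd (h : L.CanonRepresents) (hc : L.CaptureFree) :
    (BLang.bigAnd L).CanonRepresents := by
  have hfin := canon_images_finite L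
  have hsub : ∀ {l : List (Fml S V)}, (∀ φ ∈ l, φ ∈ L.formulas) →
      {ψ | ∃ φ ∈ l, ψ = L.canon φ} ⊆ L.formulas := by
    rintro l hl _ ⟨φ, hφ, rfl⟩
    exact h.mem (hl φ hφ)
  have hanti : ∀ {l l' : List (Fml S V)}, (∀ φ ∈ l, φ ∈ L.formulas) →
      (∀ φ ∈ l', φ ∈ L.formulas) → ∀ φ ∈ {ψ | ∃ φ ∈ l, ψ = L.canon φ},
      ∀ ψ ∈ {ψ | ∃ φ ∈ l', ψ = L.canon φ}, L.Sub φ ψ → L.Sub ψ φ → φ = ψ := by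
    rintro l l' hl hl' _ ⟨φ, hφ, rfl⟩ _ ⟨ψ, hψ, rfl⟩ h₁ h₂
    rw [← h.canon_canon (hl φ hφ), ← h.canon_canon (hl' ψ hψ)]
    exact h.congr (h.mem (hl φ hφ)) (h.mem (hl' ψ hψ)) h₁ h₂
  have hdom : ∀ {l : List (Fml S V)}, (∀ φ ∈ l, φ ∈ L.formulas) → ∀ φ ∈ l,
      ∃ ψ ∈ L.minSub {ψ | ∃ φ ∈ l, ψ = L.canon φ}, L.Sub ψ (L.canon φ) := fun hl φ hφ =>
    exists_minSub_sub_of_antisymm hc (hfin _) (hsub hl) (hanti hl hl) ⟨φ, hφ, rfl⟩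
  have hcongr : ∀ {l l' : List (Fml S V)}, (∀ φ ∈ l, φ ∈ L.formulas) →
      (∀ φ ∈ l', φ ∈ L.formulas) →
      (BLang.bigAnd L).Sub (.bigAnd l) (.bigAnd l') →
      (BLang.bigAnd L).Sub (.bigAnd l') (.bigAnd l) →
      L.minSub {ψ | ∃ φ ∈ l, ψ = L.canon φ} ⊆ L.minSub {ψ | ∃ φ ∈ l', ψ = L.canon φ} := by
    intro l l' hl hl' h₁ h₂
    rw [sub_bigAnd_iff] at h₁ h₂
    have below : ∀ {l l' : List (Fml S V)}, (∀ φ ∈ l, φ ∈ L.formulas) →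
        (∀ φ ∈ l', φ ∈ L.formulas) → (∀ ψ ∈ l', ∃ φ ∈ l, L.Sub φ ψ) →
        ∀ ψ ∈ {ψ | ∃ φ ∈ l', ψ = L.canon φ},
          ∃ φ ∈ {ψ | ∃ φ ∈ l, ψ = L.canon φ}, L.Sub φ ψ := by
      rintro l l' hl hl' h₁ _ ⟨ψ, hψ, rfl⟩
      obtain ⟨φ, hφ, hs⟩ := h₁ ψ hψ
      have hφL := hl φ hφ
      have hψL := hl' ψ hψ
      exact ⟨_, ⟨φ, hφ, rfl⟩, sub_trans hc (h.mem hφL) hφL (h.mem hψL) (h.canon_sub hφL)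
        (sub_trans hc hφL hψL (h.mem hψL) hs (h.sub_canon hψL))⟩
    rintro φ ⟨hφ, hmin⟩
    have hφL := hsub hl hφ
    have up : ∀ ψ ∈ {ψ | ∃ φ ∈ l', ψ = L.canon φ}, L.Sub ψ φ → ψ = φ := by
      intro ψ hψ hs
      have hψL := hsub hl' hψ
      obtain ⟨χ, hχ, hs'⟩ := below hl hl' h₁ ψ hψ
      have hχL := hsub hl hχ
      have : χ = φ := by
        by_contra hne
        exact hmin χ hχ hne (sub_trans hc hχL hψL hφL hs' hs)
      exact hanti hl' hl ψ hψ φ hφ hs (this ▸ hs')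
    obtain ⟨ψ, hψ, hs⟩ := below hl' hl h₂ φ hφ
    exact ⟨up ψ hψ hs ▸ hψ, fun χ hχ hne hs => hne (up χ hχ hs)⟩
  refine ⟨?_, ?_, ?_, ?_⟩
  · rintro _ ⟨l, hl, hne, rfl⟩
    refine ⟨_, fun φ hφ => ?_, ?_, rfl⟩
    · exact hsub hl (minSub_subset _ _ (mem_sortSet_minSub.1 hφ))
    · obtain ⟨φ, hφ⟩ := List.exists_mem_of_ne_nil l hne
      obtain ⟨ψ, hψ, -⟩ := hdom hl φ hφ
      exact List.ne_nil_of_mem (mem_sortSet_minSub.2 hψ)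
  · rintro _ ⟨l, hl, hne, rfl⟩
    rw [canon, sub_bigAnd_iff]
    intro ψ hψ
    obtain ⟨φ, hφ, rfl⟩ := minSub_subset _ _ (mem_sortSet_minSub.1 hψ)
    exact ⟨φ, hφ, h.sub_canon (hl φ hφ)⟩
  · rintro _ ⟨l, hl, hne, rfl⟩
    rw [canon, sub_bigAnd_iff]
    intro φ hφ
    obtain ⟨ψ, hψ, hs⟩ := hdom hl φ hφ
    exact ⟨ψ, mem_sortSet_minSub.2 hψ, sub_trans hc (hsub hl (minSub_subset _ _ hψ))
      (h.mem (hl φ hφ)) (hl φ hφ) hs (h.canon_sub (hl φ hφ))⟩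
  · rintro _ _ ⟨l, hl, hne, rfl⟩ ⟨l', hl', hne', rfl⟩ h₁ h₂
    rw [canon, canon, (hcongr hl hl' h₁ h₂).antisymm (hcongr hl' hl h₂ h₁)]

end CanonRepresents

theorem canonRepresents (hc : L.CaptureFree) : L.CanonRepresents := by
  induction L with
  | base B =>
    refine ⟨id, sub_refl, sub_refl, ?_⟩
    rintro _ _ ⟨f, -, rfl⟩ ⟨g, -, rfl⟩ (rfl | rfl) h
    · rcases h with rfl | rfl <;> rfl
    · rfl
  | or L₁ L₂ ih₁ ih₂ =>
    have h₁ := ih₁ hc.1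
    have h₂ := ih₂ hc.2
    refine ⟨?_, ?_, ?_, ?_⟩
    · rintro _ ⟨φ, hφ, ψ, hψ, rfl⟩
      exact ⟨_, h₁.mem hφ, _, h₂.mem hψ, rfl⟩
    · rintro _ ⟨φ, hφ, ψ, hψ, rfl⟩
      exact ⟨h₁.sub_canon hφ, h₂.sub_canon hψ⟩
    · rintro _ ⟨φ, hφ, ψ, hψ, rfl⟩
      exact ⟨h₁.canon_sub hφ, h₂.canon_sub hψ⟩
    · rintro _ _ ⟨φ, hφ, ψ, hψ, rfl⟩ ⟨φ', hφ', ψ', hψ', rfl⟩ h h'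
      rw [canon, canon, h₁.congr hφ hφ' h.1 h'.1, h₂.congr hψ hψ' h.2 h'.2]
  | and L₁ L₂ ih₁ ih₂ =>
    have h₁ := ih₁ hc.1
    have h₂ := ih₂ hc.2
    refine ⟨?_, ?_, ?_, ?_⟩
    · rintro _ ⟨φ, hφ, ψ, hψ, rfl⟩
      exact ⟨_, h₁.mem hφ, _, h₂.mem hψ, rfl⟩
    · rintro _ ⟨φ, hφ, ψ, hψ, rfl⟩
      exact ⟨h₁.sub_canon hφ, h₂.sub_canon hψ⟩
    · rintro _ ⟨φ, hφ, ψ, hψ, rfl⟩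
      exact ⟨h₁.canon_sub hφ, h₂.canon_sub hψ⟩
    · rintro _ _ ⟨φ, hφ, ψ, hψ, rfl⟩ ⟨φ', hφ', ψ', hψ', rfl⟩ h h'
      rw [canon, canon, h₁.congr hφ hφ' h.1 h'.1, h₂.congr hψ hψ' h.2 h'.2]
  | bigOr k L ih => exact (ih hc).bigOr hc k
  | bigAnd L ih => exact (ih hc).bigAnd hc
  | quant q Y L ih =>
    have h := ih hc.1
    refine ⟨?_, ?_, ?_, ?_⟩
    · rintro _ ⟨φ, hφ, rfl⟩
      exact ⟨_, (h.minLe_spec hc.1 hc.2 hφ).1, rfl⟩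
    · rintro _ ⟨φ, hφ, rfl⟩
      exact (h.minLe_spec hc.1 hc.2 hφ).2.1
    · rintro _ ⟨φ, hφ, rfl⟩
      exact (h.minLe_spec hc.1 hc.2 hφ).2.2
    · rintro _ _ ⟨φ, hφ, rfl⟩ ⟨ψ, hψ, rfl⟩ h₁ h₂
      exact congrArg (fun F => Fml.quant q Y (L.minLe F))
        (h.canonOrbit_eq hc.1 hc.2 hφ hψ h₁ h₂)
  | quantAny Y L ih =>
    have h := ih hc.1
    refine ⟨?_, ?_, ?_, ?_⟩
    · rintro _ ⟨q, φ, hφ, rfl⟩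
      exact ⟨q, _, (h.minLe_spec hc.1 hc.2 hφ).1, rfl⟩
    · rintro _ ⟨q, φ, hφ, rfl⟩
      exact ⟨(h.minLe_spec hc.1 hc.2 hφ).2.1, by cases q <;> simp⟩
    · rintro _ ⟨q, φ, hφ, rfl⟩
      exact ⟨(h.minLe_spec hc.1 hc.2 hφ).2.2, by cases q <;> simp⟩
    · rintro _ _ ⟨q, φ, hφ, rfl⟩ ⟨q', ψ, hψ, rfl⟩ ⟨h₁, hq⟩ ⟨h₂, hq'⟩
      obtain rfl : q = q' := by cases q <;> cases q' <;> simp_all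
      exact congrArg (fun F => Fml.quant q Y (L.minLe F))
        (h.canonOrbit_eq hc.1 hc.2 hφ hψ h₁ h₂)

end BLang

end Canon

/-! ### Canonical formulas -/

section Weaken

variable {S : FirstOrder.Language.{u, v}} {V : Type w} {U : Type x} {X Y : Finset V}

namespace BLang

variable {L : BLang S V}

theorem isCanonical_canon (hc : L.CaptureFree) {φ : Fml S V} (hφ : φ ∈ L.formulas) :
    L.IsCanonical (L.canon φ) :=
  ⟨(canonRepresents hc).mem hφ, (canonRepresents hc).canon_canon hφ⟩

theorem IsCanonical.antisymm (hc : L.CaptureFree) {φ ψ : Fml S V} (hφ : L.IsCanonical φ)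
    (hψ : L.IsCanonical ψ) (h : L.Sub φ ψ) (h' : L.Sub ψ φ) : φ = ψ := by
  rw [← hφ.2, ← hψ.2]
  exact (canonRepresents hc).congr hφ.1 hψ.1 h h'

theorem isCanonical_or_iff {L₁ L₂ : BLang S V} {φ₁ φ₂ : Fml S V} :
    (BLang.or L₁ L₂).IsCanonical (.or φ₁ φ₂) ↔ L₁.IsCanonical φ₁ ∧ L₂.IsCanonical φ₂ := by
  constructor
  · rintro ⟨⟨ψ₁, h₁, ψ₂, h₂, he⟩, h⟩
    obtain ⟨rfl, rfl⟩ := Fml.or.inj he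
    obtain ⟨h₁', h₂'⟩ := Fml.or.inj h
    exact ⟨⟨h₁, h₁'⟩, h₂, h₂'⟩
  · rintro ⟨⟨h₁, h₁'⟩, h₂, h₂'⟩
    exact ⟨⟨_, h₁, _, h₂, rfl⟩, by rw [canon, h₁', h₂']⟩

theorem isCanonical_and_iff {L₁ L₂ : BLang S V} {φ₁ φ₂ : Fml S V} :
    (BLang.and L₁ L₂).IsCanonical (.and φ₁ φ₂) ↔ L₁.IsCanonical φ₁ ∧ L₂.IsCanonical φ₂ := by
  constructor
  · rintro ⟨⟨ψ₁, h₁, ψ₂, h₂, he⟩, h⟩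
    obtain ⟨rfl, rfl⟩ := Fml.and.inj he
    obtain ⟨h₁', h₂'⟩ := Fml.and.inj h
    exact ⟨⟨h₁, h₁'⟩, h₂, h₂'⟩
  · rintro ⟨⟨h₁, h₁'⟩, h₂, h₂'⟩
    exact ⟨⟨_, h₁, _, h₂, rfl⟩, by rw [canon, h₁', h₂']⟩

theorem IsCanonical.of_mem_bigOr (hc : L.CaptureFree) {k : ℕ} {l : List (Fml S V)}
    (h : (BLang.bigOr k L).IsCanonical (.bigOr l)) {φ : Fml S V} (hφ : φ ∈ l) :
    L.IsCanonical φ := by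
  obtain ⟨⟨l', hl, -, he⟩, h⟩ := h
  obtain rfl := Fml.bigOr.inj he
  rw [← Fml.bigOr.inj h, mem_sort] at hφ
  obtain ⟨ψ, hψ, rfl⟩ := List.mem_map.1 hφ
  exact isCanonical_canon hc (hl ψ hψ)

theorem IsCanonical.of_mem_bigAnd (hc : L.CaptureFree) {l : List (Fml S V)}
    (h : (BLang.bigAnd L).IsCanonical (.bigAnd l)) {φ : Fml S V} (hφ : φ ∈ l) :
    L.IsCanonical φ := by
  obtain ⟨⟨l', hl, -, he⟩, h⟩ := h
  obtain rfl := Fml.bigAnd.inj he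
  rw [← Fml.bigAnd.inj h, mem_sortSet_minSub] at hφ
  obtain ⟨ψ, hψ, rfl⟩ := minSub_subset _ _ hφ
  exact isCanonical_canon hc (hl ψ hψ)

theorem IsCanonical.of_quant {q : Quant} (hc : (BLang.quant q X L).CaptureFree)
    {φ : Fml S V} (h : (BLang.quant q X L).IsCanonical (.quant q X φ)) : L.IsCanonical φ := by
  obtain ⟨⟨ψ, hψ, he⟩, h⟩ := h
  obtain ⟨-, -, rfl⟩ := Fml.quant.inj he
  obtain ⟨-, -, h⟩ := Fml.quant.inj h
  obtain ⟨π, hπ, he⟩ := (canonRepresents hc.1).minLe_mem hc.2 hψ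
  rw [← h]
  exact he ▸ isCanonical_canon hc.1 (subst_mem hπ hc.2 hψ)

theorem isCanonical_quantAny_iff {q : Quant} {φ : Fml S V} :
    (BLang.quantAny X L).IsCanonical (.quant q X φ) ↔
      (BLang.quant q X L).IsCanonical (.quant q X φ) := by
  refine and_congr ⟨?_, ?_⟩ Iff.rfl
  · rintro ⟨q', ψ, hψ, he⟩
    obtain ⟨rfl, -, rfl⟩ := Fml.quant.inj he
    exact ⟨_, hψ, rfl⟩
  · rintro ⟨ψ, hψ, he⟩
    exact ⟨q, ψ, hψ, he⟩

theorem canon_bigOr_of_isCanonical {k : ℕ} {l : List (Fml S V)}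
    (hl : ∀ φ ∈ l, L.IsCanonical φ) : (BLang.bigOr k L).canon (.bigOr l) = .bigOr (L.sort l) := by
  rw [canon, List.map_congr_left fun φ hφ => (hl φ hφ).2, List.map_id']

theorem finite_isCanonical (hc : L.CaptureFree) : {φ | L.IsCanonical φ}.Finite := by
  induction L with
  | base B =>
    refine ((B.finite.insert ⊥).image Fml.atom).subset ?_
    rintro _ ⟨⟨f, hf, rfl⟩, -⟩
    exact ⟨f, hf, rfl⟩
  | or L₁ L₂ ih₁ ih₂ =>
    refine (Set.Finite.image2 Fml.or (ih₁ hc.1) (ih₂ hc.2)).subset ?_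
    rintro _ ⟨⟨φ, hφ, ψ, hψ, rfl⟩, h⟩
    obtain ⟨h₁, h₂⟩ := isCanonical_or_iff.1 ⟨⟨φ, hφ, ψ, hψ, rfl⟩, h⟩
    exact ⟨φ, h₁, ψ, h₂, rfl⟩
  | and L₁ L₂ ih₁ ih₂ =>
    refine (Set.Finite.image2 Fml.and (ih₁ hc.1) (ih₂ hc.2)).subset ?_
    rintro _ ⟨⟨φ, hφ, ψ, hψ, rfl⟩, h⟩
    obtain ⟨h₁, h₂⟩ := isCanonical_and_iff.1 ⟨⟨φ, hφ, ψ, hψ, rfl⟩, h⟩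
    exact ⟨φ, h₁, ψ, h₂, rfl⟩
  | bigOr k L ih =>
    have : Finite {φ | L.IsCanonical φ} := ih hc
    refine ((List.finite_length_le {φ | L.IsCanonical φ} k).image
      fun l => Fml.bigOr (l.map Subtype.val)).subset ?_
    rintro _ ⟨⟨l, hl, hk, rfl⟩, h⟩
    have hcan : ∀ φ ∈ l, φ ∈ {φ | L.IsCanonical φ} := fun φ hφ =>
      IsCanonical.of_mem_bigOr (L := L) hc ⟨⟨l, hl, hk, rfl⟩, h⟩ hφ
    lift l to List {φ | L.IsCanonical φ} using hcan
    exact ⟨l, by simpa using hk, rfl⟩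
  | bigAnd L ih =>
    -- A canonical conjunction is determined by the set of its conjuncts.
    refine ((ih hc).finite_subsets.image fun F => Fml.bigAnd (L.sortSet F)).subset ?_
    rintro _ ⟨⟨l, hl, hne, rfl⟩, h⟩
    refine ⟨_, fun φ hφ => ?_, h⟩
    obtain ⟨ψ, hψ, rfl⟩ := minSub_subset _ _ hφ
    exact isCanonical_canon (L := L) hc (hl ψ hψ)
  | quant q X L ih =>
    refine ((ih hc.1).image (Fml.quant q X)).subset ?_
    rintro _ ⟨⟨ψ, hψ, rfl⟩, h⟩
    exact ⟨ψ, IsCanonical.of_quant (q := q) hc ⟨⟨ψ, hψ, rfl⟩, h⟩, rfl⟩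
  | quantAny X L ih =>
    refine (((ih hc.1).image (Fml.quant .ex X)).union
      ((ih hc.1).image (Fml.quant .all X))).subset ?_
    rintro _ ⟨⟨q, ψ, hψ, rfl⟩, h⟩
    have := IsCanonical.of_quant (q := q) hc
      (isCanonical_quantAny_iff.1 ⟨⟨q, ψ, hψ, rfl⟩, h⟩)
    cases q
    · exact Or.inl ⟨ψ, this, rfl⟩
    · exact Or.inr ⟨ψ, this, rfl⟩

/-! ### The weaken operator -/

variable [S.Structure U]

/-- The canonical formulas that `φ` subsumes and that hold at `μ`. -/
def canonAbove (L : BLang S V) (φ : Fml S V) (μ : V → U) : Set (Fml S V) :=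
  {ξ | L.IsCanonical ξ ∧ L.Sub φ ξ ∧ ξ.Sat μ}

theorem canon_sat (hc : L.CaptureFree) {φ : Fml S V} (hφ : φ ∈ L.formulas) {μ : V → U}
    (h : φ.Sat μ) : (L.canon φ).Sat μ :=
  sat_of_sub hc hφ ((canonRepresents hc).mem hφ) ((canonRepresents hc).sub_canon hφ) h

theorem canon_mem_canonAbove (hc : L.CaptureFree) {φ ψ : Fml S V} {μ : V → U}
    (hφ : φ ∈ L.formulas) (hψ : ψ ∈ L.formulas) (h : L.Sub φ ψ) (hs : ψ.Sat μ) :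
    L.canon ψ ∈ L.canonAbove φ μ :=
  ⟨isCanonical_canon hc hψ, sub_trans hc hφ hψ ((canonRepresents hc).mem hψ) h
    ((canonRepresents hc).sub_canon hψ), canon_sat hc hψ hs⟩

theorem weaken_eq_minSub_canonAbove (hc : L.CaptureFree) {φ : Fml S V} (hφ : φ ∈ L.formulas)
    (μ : V → U) : L.weaken φ μ = L.minSub (L.canonAbove φ μ) := by
  rw [weaken]
  congr 1
  ext ξ
  constructor
  · rintro ⟨ψ, hψ, hsub, hsat, rfl⟩
    exact canon_mem_canonAbove hc hφ hψ hsub hsat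
  · rintro ⟨hξ, hsub, hsat⟩
    exact ⟨ξ, hξ.1, hsub, hsat, hξ.2.symm⟩

theorem weaken_subset_canonAbove (hc : L.CaptureFree) {φ : Fml S V} (hφ : φ ∈ L.formulas)
    (μ : V → U) : L.weaken φ μ ⊆ L.canonAbove φ μ := by
  rw [weaken_eq_minSub_canonAbove hc hφ]
  exact minSub_subset _ _

theorem eq_of_mem_weaken_of_sub {φ ψ χ : Fml S V} {μ : V → U} (hψ : ψ ∈ L.weaken φ μ)
    (hχ : χ ∈ L.weaken φ μ) (h : L.Sub ψ χ) : ψ = χ := by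
  by_contra hne
  exact hχ.2 ψ hψ.1 hne h

/-- Every formula that `φ` subsumes and that holds at `μ` is subsumed by a weakening of `φ`. -/
theorem exists_mem_weaken_sub (hc : L.CaptureFree) {φ ψ : Fml S V} {μ : V → U}
    (hφ : φ ∈ L.formulas) (hψ : ψ ∈ L.formulas) (h : L.Sub φ ψ) (hs : ψ.Sat μ) :
    ∃ χ ∈ L.weaken φ μ, L.Sub χ ψ := by
  rw [weaken_eq_minSub_canonAbove hc hφ]
  obtain ⟨χ, hχ, hsub⟩ := exists_minSub_sub_of_antisymm hc (F := L.canonAbove φ μ)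
    ((finite_isCanonical hc).subset fun ξ hξ => hξ.1) (fun ξ hξ => hξ.1.1)
    (fun ξ hξ ζ hζ => hξ.1.antisymm hc hζ.1) (canon_mem_canonAbove hc hφ hψ h hs)
  exact ⟨χ, hχ, sub_trans hc (minSub_subset _ _ hχ).1.1 ((canonRepresents hc).mem hψ) hψ hsub
    ((canonRepresents hc).canon_sub hψ)⟩

/-- To compute the weakenings of `φ` it is enough to look at a set of formulas from which all of
`L.canonAbove φ μ` is reached by subsumption. -/
theorem weaken_eq_minSub (hc : L.CaptureFree) {φ : Fml S V} (hφ : φ ∈ L.formulas) {μ : V → U}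
    {F : Set (Fml S V)} (hF : F ⊆ L.canonAbove φ μ)
    (hd : ∀ ψ ∈ L.canonAbove φ μ, ∃ χ ∈ F, L.Sub χ ψ) : L.weaken φ μ = L.minSub F := by
  rw [weaken_eq_minSub_canonAbove hc hφ]
  exact minSub_eq_of_dominates hc hF (fun ξ hξ => hξ.1.1)
    (fun ξ hξ ζ hζ => hξ.1.antisymm hc hζ.1) hd

theorem weaken_eq_of_antichain (hc : L.CaptureFree) {φ : Fml S V} (hφ : φ ∈ L.formulas)
    {μ : V → U} {F : Set (Fml S V)} (hF : F ⊆ L.canonAbove φ μ)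
    (hd : ∀ ψ ∈ L.canonAbove φ μ, ∃ χ ∈ F, L.Sub χ ψ)
    (ha : ∀ ψ ∈ F, ∀ χ ∈ F, L.Sub ψ χ → ψ = χ) : L.weaken φ μ = F := by
  rw [weaken_eq_minSub hc hφ hF hd]
  exact (minSub_subset _ _).antisymm fun ψ hψ => ⟨hψ, fun χ hχ hne hs => hne (ha χ hχ ψ hψ hs)⟩

theorem weaken_eq_singleton (hc : L.CaptureFree) {φ ξ : Fml S V} (hφ : φ ∈ L.formulas)
    {μ : V → U} (hξ : ξ ∈ L.canonAbove φ μ) (hd : ∀ ψ ∈ L.canonAbove φ μ, L.Sub ξ ψ) :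
    L.weaken φ μ = {ξ} := by
  refine weaken_eq_of_antichain hc hφ (Set.singleton_subset_iff.2 hξ)
    (fun ψ hψ => ⟨ξ, rfl, hd ψ hψ⟩) ?_
  rintro _ rfl _ rfl _
  rfl

theorem weaken_of_sat (hc : L.CaptureFree) {φ : Fml S V} (hφ : L.IsCanonical φ) {μ : V → U}
    (h : φ.Sat μ) : L.weaken φ μ = {φ} :=
  weaken_eq_singleton hc hφ.1 ⟨hφ, sub_refl hφ.1, h⟩ fun _ hψ => hψ.2.1

theorem weaken_base_bot (B : BaseLang S V) (μ : V → U) :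
    (BLang.base B).weaken (.atom ⊥) μ = {ξ | ∃ g ∈ B.A, ξ = .atom g ∧ (Fml.atom g).Sat μ} := by
  have hbot : ¬ (Fml.atom (⊥ : S.Formula V)).Sat μ := fun h => by
    rw [Fml.Sat] at h
    exact h.elim
  refine weaken_eq_of_antichain (L := .base B) trivial (bot_mem (.base B)) ?_ ?_ ?_
  · rintro _ ⟨g, hg, rfl, hs⟩
    exact ⟨⟨⟨g, Or.inr hg, rfl⟩, rfl⟩, Or.inl rfl, hs⟩
  · rintro _ ⟨⟨⟨g, hg, rfl⟩, -⟩, -, hs⟩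
    rcases hg with rfl | hg
    · exact absurd hs hbot
    · exact ⟨_, ⟨g, hg, rfl, hs⟩, Or.inr rfl⟩
  · rintro _ ⟨g, hg, rfl, hs⟩ _ ⟨g', hg', rfl, hs'⟩ (rfl | rfl)
    · exact absurd hs hbot
    · rfl

theorem weaken_base_of_ne_bot (B : BaseLang S V) {f : S.Formula V} {μ : V → U}
    (hf : (BLang.base B).IsCanonical (.atom f)) (hs : ¬ (Fml.atom f).Sat μ) (hne : f ≠ ⊥) :
    (BLang.base B).weaken (.atom f) μ = ∅ := by
  refine Set.eq_empty_of_forall_notMem fun ξ hξ => ?_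
  obtain ⟨⟨⟨g, hg, rfl⟩, -⟩, hsub, hs'⟩ :=
    weaken_subset_canonAbove (L := .base B) trivial hf.1 μ hξ
  rcases hsub with rfl | rfl
  · exact hne rfl
  · exact hs hs'

theorem weaken_or {L₁ L₂ : BLang S V} {φ₁ φ₂ : Fml S V} {μ : V → U}
    (hc : (BLang.or L₁ L₂).CaptureFree) (hφ : (BLang.or L₁ L₂).IsCanonical (.or φ₁ φ₂))
    (hs : ¬ (Fml.or φ₁ φ₂).Sat μ) :
    (BLang.or L₁ L₂).weaken (.or φ₁ φ₂) μ =
      {ξ | ∃ ψ ∈ L₁.weaken φ₁ μ, ξ = .or ψ φ₂} ∪ {ξ | ∃ ψ ∈ L₂.weaken φ₂ μ, ξ = .or φ₁ ψ} := by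
  obtain ⟨h₁, h₂⟩ := isCanonical_or_iff.1 hφ
  rw [Fml.Sat, not_or] at hs
  have hW₁ := weaken_subset_canonAbove hc.1 h₁.1 μ
  have hW₂ := weaken_subset_canonAbove hc.2 h₂.1 μ
  refine weaken_eq_of_antichain hc hφ.1 ?_ ?_ ?_
  · rintro _ (⟨ψ, hψ, rfl⟩ | ⟨ψ, hψ, rfl⟩)
    · obtain ⟨hψ, hsub, hsat⟩ := hW₁ hψ
      exact ⟨isCanonical_or_iff.2 ⟨hψ, h₂⟩, ⟨hsub, sub_refl h₂.1⟩, by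
        rw [Fml.Sat]; exact Or.inl hsat⟩
    · obtain ⟨hψ, hsub, hsat⟩ := hW₂ hψ
      exact ⟨isCanonical_or_iff.2 ⟨h₁, hψ⟩, ⟨sub_refl h₁.1, hsub⟩, by
        rw [Fml.Sat]; exact Or.inr hsat⟩
  · rintro _ ⟨⟨⟨ψ₁, hψ₁, ψ₂, hψ₂, rfl⟩, -⟩, hsub, hsat⟩
    rw [Fml.Sat] at hsat
    rcases hsat with hsat | hsat
    · obtain ⟨χ, hχ, hsub'⟩ := exists_mem_weaken_sub hc.1 h₁.1 hψ₁ hsub.1 hsat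
      exact ⟨_, Or.inl ⟨χ, hχ, rfl⟩, hsub', hsub.2⟩
    · obtain ⟨χ, hχ, hsub'⟩ := exists_mem_weaken_sub hc.2 h₂.1 hψ₂ hsub.2 hsat
      exact ⟨_, Or.inr ⟨χ, hχ, rfl⟩, hsub.1, hsub'⟩
  · -- A weakening of `φ₁` holds at `μ`, so it does not subsume `φ₁`; likewise for `φ₂`.
    rintro _ (⟨ψ, hψ, rfl⟩ | ⟨ψ, hψ, rfl⟩) _ (⟨χ, hχ, rfl⟩ | ⟨χ, hχ, rfl⟩) hsub
    · rw [eq_of_mem_weaken_of_sub hψ hχ hsub.1]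
    · exact absurd (sat_of_sub hc.1 (hW₁ hψ).1.1 h₁.1 hsub.1 (hW₁ hψ).2.2) hs.1
    · exact absurd (sat_of_sub hc.2 (hW₂ hψ).1.1 h₂.1 hsub.2 (hW₂ hψ).2.2) hs.2
    · rw [eq_of_mem_weaken_of_sub hψ hχ hsub.2]

theorem weaken_and {L₁ L₂ : BLang S V} {φ₁ φ₂ : Fml S V} (μ : V → U)
    (hc : (BLang.and L₁ L₂).CaptureFree) (hφ : (BLang.and L₁ L₂).IsCanonical (.and φ₁ φ₂)) :
    (BLang.and L₁ L₂).weaken (.and φ₁ φ₂) μ =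
      {ξ | ∃ ψ₁ ∈ L₁.weaken φ₁ μ, ∃ ψ₂ ∈ L₂.weaken φ₂ μ, ξ = .and ψ₁ ψ₂} := by
  obtain ⟨h₁, h₂⟩ := isCanonical_and_iff.1 hφ
  refine weaken_eq_of_antichain hc hφ.1 ?_ ?_ ?_
  · rintro _ ⟨ψ₁, hψ₁, ψ₂, hψ₂, rfl⟩
    obtain ⟨hψ₁, hsub₁, hsat₁⟩ := weaken_subset_canonAbove hc.1 h₁.1 μ hψ₁
    obtain ⟨hψ₂, hsub₂, hsat₂⟩ := weaken_subset_canonAbove hc.2 h₂.1 μ hψ₂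
    exact ⟨isCanonical_and_iff.2 ⟨hψ₁, hψ₂⟩, ⟨hsub₁, hsub₂⟩, by
      rw [Fml.Sat]; exact ⟨hsat₁, hsat₂⟩⟩
  · rintro _ ⟨⟨⟨ψ₁, hψ₁, ψ₂, hψ₂, rfl⟩, -⟩, hsub, hsat⟩
    rw [Fml.Sat] at hsat
    obtain ⟨χ₁, hχ₁, hsub₁⟩ := exists_mem_weaken_sub hc.1 h₁.1 hψ₁ hsub.1 hsat.1
    obtain ⟨χ₂, hχ₂, hsub₂⟩ := exists_mem_weaken_sub hc.2 h₂.1 hψ₂ hsub.2 hsat.2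
    exact ⟨_, ⟨χ₁, hχ₁, χ₂, hχ₂, rfl⟩, hsub₁, hsub₂⟩
  · rintro _ ⟨ψ₁, hψ₁, ψ₂, hψ₂, rfl⟩ _ ⟨χ₁, hχ₁, χ₂, hχ₂, rfl⟩ hsub
    rw [eq_of_mem_weaken_of_sub hψ₁ hχ₁ hsub.1, eq_of_mem_weaken_of_sub hψ₂ hχ₂ hsub.2]

theorem weaken_bigOr {k : ℕ} {l : List (Fml S V)} {μ : V → U} (hc : L.CaptureFree)
    (hφ : (BLang.bigOr k L).IsCanonical (.bigOr l)) :
    (BLang.bigOr k L).weaken (.bigOr l) μ =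
      (BLang.bigOr k L).minSub
        ({ξ | ∃ i : Fin l.length, ∃ ψ ∈ L.weaken (l.get i) μ, ξ = .bigOr (L.sort (l.set i ψ))} ∪
          {ξ | ∃ ψ ∈ L.weaken L.bot μ, l.length < k ∧ ξ = .bigOr (L.sort (l ++ [ψ]))}) := by
  have hlc : ∀ φ ∈ l, L.IsCanonical φ := fun φ h => hφ.of_mem_bigOr hc h
  have hget : ∀ i, L.IsCanonical (l.get i) := fun i => hlc _ (List.get_mem l i)
  have hk : l.length ≤ k := by
    obtain ⟨l', -, hk, he⟩ := hφ.1
    rwa [Fml.bigOr.inj he]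
  have hsetc : ∀ (i : Fin l.length) (ψ : Fml S V), L.IsCanonical ψ →
      ∀ φ ∈ l.set i ψ, L.IsCanonical φ := by
    intro i ψ hψ φ h
    rcases List.mem_or_eq_of_mem_set h with h | rfl
    · exact hlc φ h
    · exact hψ
  have happc : ∀ (ψ : Fml S V), L.IsCanonical ψ → ∀ φ ∈ l ++ [ψ], L.IsCanonical φ := by
    intro ψ hψ φ h
    rcases List.mem_append.1 h with h | h
    · exact hlc φ h
    · rwa [List.mem_singleton.1 h]
  have hmem : ∀ l' : List (Fml S V), (∀ φ ∈ l', L.IsCanonical φ) → l'.length ≤ k →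
      Fml.bigOr l' ∈ (BLang.bigOr k L).formulas := fun l' hl' hk' =>
    ⟨l', fun φ h => (hl' φ h).1, hk', rfl⟩
  refine weaken_eq_minSub (L := .bigOr k L) hc hφ.1 ?_ ?_
  · rintro _ (⟨i, ψ, hψ, rfl⟩ | ⟨ψ, hψ, hlt, rfl⟩)
    · obtain ⟨hψ, hsub, hsat⟩ := weaken_subset_canonAbove hc (hget i).1 μ hψ
      rw [← canon_bigOr_of_isCanonical (k := k) (hsetc i ψ hψ)]
      refine canon_mem_canonAbove (L := .bigOr k L) hc hφ.1
        (hmem _ (hsetc i ψ hψ) (by simpa using hk)) ?_ ?_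
      · refine ⟨Fin.cast (List.length_set).symm, fun j => ?_, Fin.cast_injective _⟩
        by_cases hij : i = j
        · subst hij
          simpa using hsub
        · have hne : (i : ℕ) ≠ j := fun h => hij (Fin.ext h)
          simpa [List.getElem_set_ne hne] using sub_refl (hget j).1
      · rw [Fml.Sat]
        exact ⟨ψ, List.mem_set i.2 ψ, hsat⟩
    · obtain ⟨hψ, -, hsat⟩ := weaken_subset_canonAbove hc (bot_mem L) μ hψ
      rw [← canon_bigOr_of_isCanonical (k := k) (happc ψ hψ)]
      refine canon_mem_canonAbove (L := .bigOr k L) hc hφ.1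
        (hmem _ (happc ψ hψ) (by simpa using hlt)) ?_ ?_
      · refine ⟨Fin.castLE (by simp), fun j => ?_, Fin.castLE_injective _⟩
        simpa [List.getElem_append_left] using sub_refl (hget j).1
      · rw [Fml.Sat]
        exact ⟨ψ, by simp, hsat⟩
  · rintro _ ⟨⟨⟨l', hl', hk', rfl⟩, -⟩, ⟨m, hm, hinj⟩, hsat⟩
    rw [Fml.Sat] at hsat
    obtain ⟨ψ, hψ, hsat⟩ := hsat
    obtain ⟨j, rfl⟩ := List.mem_iff_get.1 hψ
    -- It suffices to subsume before sorting.
    have below : ∀ l₁ : List (Fml S V), (∀ φ ∈ l₁, L.IsCanonical φ) → l₁.length ≤ k →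
        (BLang.bigOr k L).Sub (.bigOr l₁) (.bigOr l') →
        (BLang.bigOr k L).Sub (.bigOr (L.sort l₁)) (.bigOr l') := by
      intro l₁ hl₁ hk₁ hs
      rw [← canon_bigOr_of_isCanonical (k := k) hl₁]
      have hr : (BLang.bigOr k L).CanonRepresents := canonRepresents hc
      have hm := hmem l₁ hl₁ hk₁
      exact sub_trans (L := .bigOr k L) hc (hr.mem hm) hm ⟨l', hl', hk', rfl⟩ (hr.canon_sub hm) hs
    by_cases hj : ∃ i, m i = j
    · obtain ⟨i, rfl⟩ := hj
      obtain ⟨χ, hχ, hsub⟩ := exists_mem_weaken_sub hc (hget i).1 (hl' _ hψ) (hm i) hsat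
      have hχc := (weaken_subset_canonAbove hc (hget i).1 μ hχ).1
      refine ⟨_, Or.inl ⟨i, χ, hχ, rfl⟩, below _ (hsetc i χ hχc) (by simpa using hk) ?_⟩
      refine ⟨fun a => m (a.cast List.length_set), fun a => ?_,
        fun a b hab => Fin.cast_injective _ (hinj hab)⟩
      obtain ⟨a, rfl⟩ : ∃ b : Fin l.length, a = b.cast List.length_set.symm :=
        ⟨a.cast List.length_set, rfl⟩
      by_cases hia : i = a
      · subst hia
        simpa using hsub
      · have hne : (i : ℕ) ≠ a := fun h => hia (Fin.ext h)
        simpa [List.getElem_set_ne hne] using hm a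
    · -- The satisfied disjunct of `l'` is not used by `m`: there is room for one more disjunct.
      have hlt : l.length < l'.length := by
        simpa using Fintype.card_lt_of_injective_of_notMem m hinj (b := j) (by simpa using hj)
      obtain ⟨χ, hχ, hsub⟩ := exists_mem_weaken_sub hc (bot_mem L) (hl' _ hψ)
        (bot_sub (hl' _ hψ)) hsat
      have hχc := (weaken_subset_canonAbove hc (bot_mem L) μ hχ).1
      have hlk := hlt.trans_le hk'
      refine ⟨_, Or.inr ⟨χ, hχ, hlk, rfl⟩, below _ (happc χ hχc) (by simpa using hlk) ?_⟩
      have hlen : (l ++ [χ]).length = l.length + 1 := by simp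
      have hinj' : Function.Injective
          (Fin.lastCases (motive := fun _ => Fin l'.length) j m) := by
        intro a b
        refine Fin.lastCases ?_ (fun a => ?_) a <;> refine Fin.lastCases ?_ (fun b => ?_) b
        · exact fun _ => rfl
        · simp only [Fin.lastCases_last, Fin.lastCases_castSucc]
          exact fun h => absurd ⟨b, h.symm⟩ hj
        · simp only [Fin.lastCases_last, Fin.lastCases_castSucc]
          exact fun h => absurd ⟨a, h⟩ hj
        · simp only [Fin.lastCases_castSucc]
          exact fun h => congrArg Fin.castSucc (hinj h)
      refine ⟨fun a => Fin.lastCases (motive := fun _ => Fin l'.length) j m (a.cast hlen),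
        fun a => ?_, fun a b hab => Fin.cast_injective hlen (hinj' hab)⟩
      obtain ⟨a, rfl⟩ : ∃ b : Fin (l.length + 1), a = b.cast hlen.symm :=
        ⟨a.cast hlen, rfl⟩
      refine Fin.lastCases ?_ (fun a => ?_) a
      · simpa using hsub
      · simpa [List.getElem_append_left] using hm a

theorem finite_iUnion_weaken (hc : L.CaptureFree) {l : List (Fml S V)}
    (hl : ∀ φ ∈ l, φ ∈ L.formulas) (μ : V → U) : (⋃ φ ∈ l, L.weaken φ μ).Finite := by
  refine (finite_isCanonical hc).subset (Set.iUnion₂_subset fun φ hφ ψ hψ => ?_)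
  exact (weaken_subset_canonAbove hc (hl φ hφ) μ hψ).1

theorem weaken_bigAnd_of_nonempty {l : List (Fml S V)} {μ : V → U} (hc : L.CaptureFree)
    (hφ : (BLang.bigAnd L).IsCanonical (.bigAnd l)) (hne : (⋃ φ ∈ l, L.weaken φ μ).Nonempty) :
    (BLang.bigAnd L).weaken (.bigAnd l) μ =
      {.bigAnd (L.sortSet (L.minSub (⋃ φ ∈ l, L.weaken φ μ)))} := by
  have hl : ∀ φ ∈ l, φ ∈ L.formulas := fun φ h => (hφ.of_mem_bigAnd hc h).1
  set M := ⋃ φ ∈ l, L.weaken φ μ with hM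
  have hfin : M.Finite := finite_iUnion_weaken hc hl μ
  have hmem : ∀ ψ ∈ M, ∃ φ ∈ l, ψ ∈ L.canonAbove φ μ := by
    intro ψ hψ
    obtain ⟨φ, hφ, hψ⟩ := Set.mem_iUnion₂.1 hψ
    exact ⟨φ, hφ, weaken_subset_canonAbove hc (hl φ hφ) μ hψ⟩
  have hlist : ∀ ψ, ψ ∈ hfin.toFinset.toList ↔ ψ ∈ M := by simp
  -- The formula in question is the canonicalization of the conjunction over all of `M`.
  have hcanon : (BLang.bigAnd L).canon (.bigAnd hfin.toFinset.toList) =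
      .bigAnd (L.sortSet (L.minSub M)) := by
    rw [canon]
    congr 3
    ext ψ
    constructor
    · rintro ⟨φ, hφ, rfl⟩
      rw [hlist] at hφ
      obtain ⟨_, _, h⟩ := hmem φ hφ
      rwa [h.1.2]
    · intro hψ
      obtain ⟨_, _, h⟩ := hmem ψ hψ
      exact ⟨ψ, (hlist ψ).2 hψ, h.1.2.symm⟩
  have hMf : Fml.bigAnd hfin.toFinset.toList ∈ (BLang.bigAnd L).formulas := by
    refine ⟨_, fun ψ hψ => ?_, ?_, rfl⟩
    · obtain ⟨_, _, h⟩ := hmem ψ ((hlist ψ).1 hψ)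
      exact h.1.1
    · obtain ⟨ψ, hψ⟩ := hne
      exact List.ne_nil_of_mem ((hlist ψ).2 hψ)
  have hr : (BLang.bigAnd L).CanonRepresents := canonRepresents hc
  rw [← hcanon]
  refine weaken_eq_singleton (L := .bigAnd L) hc hφ.1
    (canon_mem_canonAbove (L := .bigAnd L) hc hφ.1 hMf ?_ ?_) ?_
  · rw [sub_bigAnd_iff]
    intro ψ hψ
    obtain ⟨φ, hφ, h⟩ := hmem ψ ((hlist ψ).1 hψ)
    exact ⟨φ, hφ, h.2.1⟩
  · rw [Fml.Sat]
    intro ψ hψ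
    obtain ⟨_, _, h⟩ := hmem ψ ((hlist ψ).1 hψ)
    exact h.2.2
  · rintro _ ⟨⟨⟨l', hl', hne', rfl⟩, -⟩, hsub, hsat⟩
    refine sub_trans (L := .bigAnd L) hc (hr.mem hMf) hMf ⟨l', hl', hne', rfl⟩
      (hr.canon_sub hMf) ?_
    rw [sub_bigAnd_iff] at hsub ⊢
    rw [Fml.Sat] at hsat
    intro ψ hψ
    obtain ⟨φ, hφ, hs⟩ := hsub ψ hψ
    obtain ⟨χ, hχ, hs'⟩ := exists_mem_weaken_sub hc (hl φ hφ) (hl' ψ hψ) hs (hsat ψ hψ)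
    exact ⟨χ, (hlist χ).2 (Set.mem_iUnion₂.2 ⟨φ, hφ, hχ⟩), hs'⟩

theorem weaken_bigAnd_of_empty {l : List (Fml S V)} {μ : V → U} (hc : L.CaptureFree)
    (hφ : (BLang.bigAnd L).IsCanonical (.bigAnd l)) (he : (⋃ φ ∈ l, L.weaken φ μ) = ∅) :
    (BLang.bigAnd L).weaken (.bigAnd l) μ = ∅ := by
  refine Set.eq_empty_of_forall_notMem fun ξ hξ => ?_
  obtain ⟨⟨⟨l', hl', hne', rfl⟩, -⟩, hsub, hsat⟩ :=
    weaken_subset_canonAbove (L := .bigAnd L) hc hφ.1 μ hξ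
  rw [sub_bigAnd_iff] at hsub
  rw [Fml.Sat] at hsat
  -- Conjunctions are not empty.
  obtain ⟨ψ, hψ⟩ := List.exists_mem_of_ne_nil l' hne'
  obtain ⟨φ, hφ', hs⟩ := hsub ψ hψ
  obtain ⟨χ, hχ, -⟩ := exists_mem_weaken_sub hc (hφ.of_mem_bigAnd hc hφ').1 (hl' ψ hψ) hs
    (hsat ψ hψ)
  exact (he ▸ Set.mem_iUnion₂.2 ⟨φ, hφ', hχ⟩ : χ ∈ (∅ : Set (Fml S V)))

theorem quant_sub_quant_of_sub {q q' : Quant} {φ ψ : Fml S V} (h : L.Sub φ ψ) :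
    (BLang.quant q X L).Sub (.quant q' X φ) (.quant q' X ψ) :=
  ⟨1, one_mem_permsOn, by rwa [subst_one]⟩

theorem canon_quant_sub_of_sub_subst {q : Quant} (hc : (BLang.quant q X L).CaptureFree)
    {φ ψ : Fml S V} (hφ : φ ∈ L.formulas) (hψ : ψ ∈ L.formulas) {π : Equiv.Perm V}
    (hπ : π ∈ permsOn X) (h : L.Sub φ (ψ.subst π)) :
    (BLang.quant q X L).Sub ((BLang.quant q X L).canon (.quant q X φ)) (.quant q X ψ) := by
  have hr : (BLang.quant q X L).CanonRepresents := canonRepresents hc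
  have hφ' : Fml.quant q X φ ∈ (BLang.quant q X L).formulas := ⟨φ, hφ, rfl⟩
  exact sub_trans (L := .quant q X L) hc (hr.mem hφ') hφ' ⟨ψ, hψ, rfl⟩ (hr.canon_sub hφ')
    ⟨π, hπ, h⟩

theorem weaken_quant_ex {φ : Fml S V} {μ : V → U} (hc : (BLang.quant .ex X L).CaptureFree)
    (hφ : (BLang.quant .ex X L).IsCanonical (.quant .ex X φ)) :
    (BLang.quant .ex X L).weaken (.quant .ex X φ) μ =
      (BLang.quant .ex X L).minSub
        {ξ | ∃ ν : X → U, ∃ ψ ∈ L.weaken φ (updateOn μ ν),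
          ξ = (BLang.quant .ex X L).canon (.quant .ex X ψ)} := by
  have hφL := (hφ.of_quant hc).1
  refine weaken_eq_minSub hc hφ.1 ?_ ?_
  · rintro _ ⟨ν, ψ, hψ, rfl⟩
    obtain ⟨hψ, hsub, hsat⟩ := weaken_subset_canonAbove hc.1 hφL _ hψ
    refine canon_mem_canonAbove hc hφ.1 ⟨ψ, hψ.1, rfl⟩ (quant_sub_quant_of_sub hsub) ?_
    rw [Fml.Sat]
    exact ⟨ν, hsat⟩
  · rintro _ ⟨⟨⟨ψ, hψ, rfl⟩, -⟩, ⟨π, hπ, hsub⟩, hsat⟩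
    rw [Fml.Sat] at hsat
    obtain ⟨ν, hsat⟩ := hsat
    obtain ⟨ν', hν'⟩ := updateOn_comp_perm (inv_mem_permsOn hπ) μ ν
    have hsat' : (ψ.subst π).Sat (updateOn μ ν') := by
      rwa [sat_subst hπ hc.2 hψ, ← hν', Function.comp_assoc, ← Equiv.Perm.coe_mul,
        inv_mul_cancel]
    obtain ⟨χ, hχ, hs⟩ := exists_mem_weaken_sub hc.1 hφL (subst_mem hπ hc.2 hψ) hsub hsat'
    exact ⟨_, ⟨ν', χ, hχ, rfl⟩, canon_quant_sub_of_sub_subst hc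
      (weaken_subset_canonAbove hc.1 hφL _ hχ).1.1 hψ hπ hs⟩

theorem mem_iterWeaken (hc : L.CaptureFree) {states : List (V → U)} {φ ξ : Fml S V}
    (hφ : φ ∈ L.formulas) (h : ξ ∈ L.iterWeaken φ states) :
    ξ ∈ L.formulas ∧ L.Sub φ ξ ∧ ∀ μ ∈ states, ξ.Sat μ := by
  induction states generalizing φ with
  | nil =>
    obtain rfl : ξ = φ := h
    exact ⟨hφ, sub_refl hφ, by simp⟩
  | cons μ states ih =>
    obtain ⟨ψ, hψ, h⟩ := h
    obtain ⟨hψ, hsub, hsat⟩ := weaken_subset_canonAbove hc hφ μ hψ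
    obtain ⟨hξ, hsub', hsat'⟩ := ih hψ.1 h
    refine ⟨hξ, sub_trans hc hφ hψ.1 hξ hsub hsub', ?_⟩
    rw [List.forall_mem_cons]
    exact ⟨sat_of_sub hc hψ.1 hξ hsub' hsat, hsat'⟩

theorem exists_mem_iterWeaken_sub (hc : L.CaptureFree) {states : List (V → U)} {φ ψ : Fml S V}
    (hφ : φ ∈ L.formulas) (hψ : ψ ∈ L.formulas) (h : L.Sub φ ψ) (hs : ∀ μ ∈ states, ψ.Sat μ) :
    ∃ ξ ∈ L.iterWeaken φ states, L.Sub ξ ψ := by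
  induction states generalizing φ with
  | nil => exact ⟨φ, rfl, h⟩
  | cons μ states ih =>
    rw [List.forall_mem_cons] at hs
    obtain ⟨χ, hχ, hsub⟩ := exists_mem_weaken_sub hc hφ hψ h hs.1
    obtain ⟨ξ, hξ, hsub'⟩ := ih (weaken_subset_canonAbove hc hφ μ hχ).1.1 hsub hs.2
    exact ⟨ξ, ⟨χ, hχ, hξ⟩, hsub'⟩

theorem weaken_quant_all {φ : Fml S V} {μ : V → U} (hc : (BLang.quant .all X L).CaptureFree)
    (hφ : (BLang.quant .all X L).IsCanonical (.quant .all X φ)) {states : List (V → U)}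
    (hst : ∀ σ, σ ∈ states ↔ ∃ ν : X → U, σ = updateOn μ ν) :
    (BLang.quant .all X L).weaken (.quant .all X φ) μ =
      (BLang.quant .all X L).minSub
        {ξ | ∃ ψ ∈ L.iterWeaken φ states,
          ξ = (BLang.quant .all X L).canon (.quant .all X ψ)} := by
  have hφL := (hφ.of_quant hc).1
  refine weaken_eq_minSub hc hφ.1 ?_ ?_
  · rintro _ ⟨ψ, hψ, rfl⟩
    obtain ⟨hψ, hsub, hsat⟩ := mem_iterWeaken hc.1 hφL hψ
    refine canon_mem_canonAbove hc hφ.1 ⟨ψ, hψ, rfl⟩ (quant_sub_quant_of_sub hsub) ?_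
    rw [Fml.Sat]
    exact fun ν => hsat _ ((hst _).2 ⟨ν, rfl⟩)
  · rintro _ ⟨⟨⟨ψ, hψ, rfl⟩, -⟩, ⟨π, hπ, hsub⟩, hsat⟩
    rw [Fml.Sat] at hsat
    obtain ⟨χ, hχ, hs⟩ := exists_mem_iterWeaken_sub hc.1 (states := states) hφL
      (subst_mem hπ hc.2 hψ) hsub fun σ hσ => by
        obtain ⟨ν, rfl⟩ := (hst σ).1 hσ
        obtain ⟨ν', hν'⟩ := updateOn_comp_perm hπ μ ν
        rw [sat_subst hπ hc.2 hψ, hν']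
        exact hsat ν'
    exact ⟨_, ⟨χ, hχ, rfl⟩, canon_quant_sub_of_sub_subst hc
      (mem_iterWeaken hc.1 hφL hχ).1 hψ hπ hs⟩

theorem weaken_quantAny_ex {φ : Fml S V} {μ : V → U} (hc : (BLang.quantAny X L).CaptureFree)
    (hφ : (BLang.quantAny X L).IsCanonical (.quant .ex X φ)) :
    (BLang.quantAny X L).weaken (.quant .ex X φ) μ =
      (BLang.quant .ex X L).weaken (.quant .ex X φ) μ := by
  have hφ' := isCanonical_quantAny_iff.1 hφ
  refine weaken_eq_of_antichain hc hφ.1 ?_ ?_ ?_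
  · intro ξ hξ
    obtain ⟨h, hsub, hsat⟩ := weaken_subset_canonAbove (L := .quant .ex X L) hc hφ'.1 μ hξ
    obtain ⟨ψ, hψ, rfl⟩ := h.1
    exact ⟨isCanonical_quantAny_iff.2 h, ⟨hsub, Or.inr rfl⟩, hsat⟩
  · rintro _ ⟨⟨⟨q, ψ, hψ, rfl⟩, hψc⟩, ⟨hsub, hq⟩, hsat⟩
    obtain rfl : q = .ex := by simpa using hq
    obtain ⟨χ, hχ, hs⟩ := exists_mem_weaken_sub (L := .quant .ex X L) hc hφ'.1
      ⟨ψ, hψ, rfl⟩ hsub hsat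
    obtain ⟨⟨⟨ζ, hζ, rfl⟩, -⟩, -⟩ :=
      weaken_subset_canonAbove (L := .quant .ex X L) hc hφ'.1 μ hχ
    exact ⟨_, hχ, hs, Or.inr rfl⟩
  · intro ψ hψ χ hχ hs
    refine eq_of_mem_weaken_of_sub hψ hχ ?_
    obtain ⟨⟨⟨ζ, hζ, rfl⟩, -⟩, -⟩ :=
      weaken_subset_canonAbove (L := .quant .ex X L) hc hφ'.1 μ hψ
    obtain ⟨⟨⟨ζ', hζ', rfl⟩, -⟩, -⟩ :=
      weaken_subset_canonAbove (L := .quant .ex X L) hc hφ'.1 μ hχ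
    exact hs.1

theorem weaken_quantAny_all {φ : Fml S V} {μ : V → U} (hc : (BLang.quantAny X L).CaptureFree)
    (hφ : (BLang.quantAny X L).IsCanonical (.quant .all X φ)) :
    (BLang.quantAny X L).weaken (.quant .all X φ) μ =
      (BLang.quantAny X L).minSub
        ((BLang.quant .ex X L).weaken (.quant .ex X φ) μ ∪
          (BLang.quant .all X L).weaken (.quant .all X φ) μ) := by
  have hφL := ((isCanonical_quantAny_iff.1 hφ).of_quant hc).1
  have hmem : ∀ q, Fml.quant q X φ ∈ (BLang.quant q X L).formulas := fun q => ⟨φ, hφL, rfl⟩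
  refine weaken_eq_minSub hc hφ.1 ?_ ?_
  · have key : ∀ q, (BLang.quant q X L).weaken (.quant q X φ) μ ⊆
        (BLang.quantAny X L).canonAbove (.quant .all X φ) μ := by
      intro q ξ hξ
      obtain ⟨h, hsub, hsat⟩ := weaken_subset_canonAbove (L := .quant q X L) hc (hmem q) μ hξ
      obtain ⟨ψ, hψ, rfl⟩ := h.1
      exact ⟨isCanonical_quantAny_iff.2 h, ⟨hsub, Or.inl rfl⟩, hsat⟩
    exact Set.union_subset (key .ex) (key .all)
  · rintro _ ⟨⟨⟨q, ψ, hψ, rfl⟩, -⟩, ⟨hsub, -⟩, hsat⟩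
    obtain ⟨χ, hχ, hs⟩ := exists_mem_weaken_sub (L := .quant q X L) hc (hmem q)
      ⟨ψ, hψ, rfl⟩ hsub hsat
    obtain ⟨⟨⟨ζ, hζ, rfl⟩, -⟩, -⟩ :=
      weaken_subset_canonAbove (L := .quant q X L) hc (hmem q) μ hχ
    refine ⟨.quant q X ζ, ?_, hs, by cases q <;> simp⟩
    cases q
    · exact Or.inl hχ
    · exact Or.inr hχ

end BLang

end Weaken

theorem theorem4 {S : FirstOrder.Language.{u, v}} {V : Type w} {U : Type x} [S.Structure U]
    [Finite U] (μ : V → U) :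
    -- a formula that is satisfied
    (∀ (L : BLang S V) (φ : Fml S V), L.CaptureFree → L.IsCanonical φ → φ.Sat μ →
      L.weaken φ μ = {φ}) ∧
    -- base language
    (∀ (B : BaseLang S V) (f : S.Formula V),
      (BLang.base B).IsCanonical (.atom f) → ¬ (Fml.atom f).Sat μ →
      (f = ⊥ → (BLang.base B).weaken (.atom f) μ =
        {ξ | ∃ g ∈ B.A, ξ = .atom g ∧ (Fml.atom g).Sat μ}) ∧
      (f ≠ ⊥ → (BLang.base B).weaken (.atom f) μ = ∅)) ∧
    -- binary disjunction
    (∀ (L₁ L₂ : BLang S V) (φ₁ φ₂ : Fml S V), (BLang.or L₁ L₂).CaptureFree →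
      (BLang.or L₁ L₂).IsCanonical (.or φ₁ φ₂) → ¬ (Fml.or φ₁ φ₂).Sat μ →
      (BLang.or L₁ L₂).weaken (.or φ₁ φ₂) μ =
        {ξ | ∃ ψ ∈ L₁.weaken φ₁ μ, ξ = .or ψ φ₂} ∪ {ξ | ∃ ψ ∈ L₂.weaken φ₂ μ, ξ = .or φ₁ ψ}) ∧
    -- binary conjunction
    (∀ (L₁ L₂ : BLang S V) (φ₁ φ₂ : Fml S V), (BLang.and L₁ L₂).CaptureFree →
      (BLang.and L₁ L₂).IsCanonical (.and φ₁ φ₂) → ¬ (Fml.and φ₁ φ₂).Sat μ →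
      (BLang.and L₁ L₂).weaken (.and φ₁ φ₂) μ =
        {ξ | ∃ ψ₁ ∈ L₁.weaken φ₁ μ, ∃ ψ₂ ∈ L₂.weaken φ₂ μ, ξ = .and ψ₁ ψ₂}) ∧
    -- homogeneous disjunction of at most `k` formulas
    (∀ (k : ℕ) (L : BLang S V) (l : List (Fml S V)), (BLang.bigOr k L).CaptureFree →
      (BLang.bigOr k L).IsCanonical (.bigOr l) → ¬ (Fml.bigOr l).Sat μ →
      (BLang.bigOr k L).weaken (.bigOr l) μ =
        (BLang.bigOr k L).minSub
          ({ξ | ∃ i : Fin l.length, ∃ ψ ∈ L.weaken (l.get i) μ, ξ = .bigOr (L.sort (l.set i ψ))} ∪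
            {ξ | ∃ ψ ∈ L.weaken L.bot μ, l.length < k ∧ ξ = .bigOr (L.sort (l ++ [ψ]))})) ∧
    -- homogeneous non-empty conjunction
    (∀ (L : BLang S V) (l : List (Fml S V)), (BLang.bigAnd L).CaptureFree →
      (BLang.bigAnd L).IsCanonical (.bigAnd l) → ¬ (Fml.bigAnd l).Sat μ →
      (((⋃ φ ∈ l, L.weaken φ μ).Finite) ∧
      ((⋃ φ ∈ l, L.weaken φ μ).Nonempty → (BLang.bigAnd L).weaken (.bigAnd l) μ =
        {.bigAnd (L.sortSet (L.minSub (⋃ φ ∈ l, L.weaken φ μ)))}) ∧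
      ((⋃ φ ∈ l, L.weaken φ μ) = ∅ → (BLang.bigAnd L).weaken (.bigAnd l) μ = ∅))) ∧
    -- existential quantification
    (∀ (X : Finset V) (L : BLang S V) (φ : Fml S V), (BLang.quant .ex X L).CaptureFree →
      (BLang.quant .ex X L).IsCanonical (.quant .ex X φ) → ¬ (Fml.quant .ex X φ).Sat μ →
      (BLang.quant .ex X L).weaken (.quant .ex X φ) μ =
        (BLang.quant .ex X L).minSub
          {ξ | ∃ ν : X → U, ∃ ψ ∈ L.weaken φ (updateOn μ ν),
            ξ = (BLang.quant .ex X L).canon (.quant .ex X ψ)}) ∧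
    -- universal quantification, for every enumeration of the updated states
    (∀ (X : Finset V) (L : BLang S V) (φ : Fml S V), (BLang.quant .all X L).CaptureFree →
      (BLang.quant .all X L).IsCanonical (.quant .all X φ) → ¬ (Fml.quant .all X φ).Sat μ →
      ∀ states : List (V → U), (∀ σ, σ ∈ states ↔ ∃ ν : X → U, σ = updateOn μ ν) →
      (BLang.quant .all X L).weaken (.quant .all X φ) μ =
        (BLang.quant .all X L).minSub
          {ξ | ∃ ψ ∈ L.iterWeaken φ states,
            ξ = (BLang.quant .all X L).canon (.quant .all X ψ)}) ∧
    -- both quantifiers, existential formula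
    (∀ (X : Finset V) (L : BLang S V) (φ : Fml S V), (BLang.quantAny X L).CaptureFree →
      (BLang.quantAny X L).IsCanonical (.quant .ex X φ) → ¬ (Fml.quant .ex X φ).Sat μ →
      (BLang.quantAny X L).weaken (.quant .ex X φ) μ =
        (BLang.quant .ex X L).weaken (.quant .ex X φ) μ) ∧
    -- both quantifiers, universal formula
    (∀ (X : Finset V) (L : BLang S V) (φ : Fml S V), (BLang.quantAny X L).CaptureFree →
      (BLang.quantAny X L).IsCanonical (.quant .all X φ) → ¬ (Fml.quant .all X φ).Sat μ →
      (BLang.quantAny X L).weaken (.quant .all X φ) μ =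
        (BLang.quantAny X L).minSub
          ((BLang.quant .ex X L).weaken (.quant .ex X φ) μ ∪
            (BLang.quant .all X L).weaken (.quant .all X φ) μ)) := by
  refine ⟨fun L φ hc hφ hs => BLang.weaken_of_sat hc hφ hs, fun B f hf hs => ⟨?_, ?_⟩,
    fun L₁ L₂ φ₁ φ₂ hc hφ hs => BLang.weaken_or hc hφ hs,
    fun L₁ L₂ φ₁ φ₂ hc hφ _ => BLang.weaken_and μ hc hφ,
    fun k L l hc hφ _ => BLang.weaken_bigOr hc hφ,
    fun L l hc hφ _ => ⟨?_, BLang.weaken_bigAnd_of_nonempty hc hφ,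
      BLang.weaken_bigAnd_of_empty hc hφ⟩,
    fun X L φ hc hφ _ => BLang.weaken_quant_ex hc hφ,
    fun X L φ hc hφ _ states hst => BLang.weaken_quant_all hc hφ hst,
    fun X L φ hc hφ _ => BLang.weaken_quantAny_ex hc hφ,
    fun X L φ hc hφ _ => BLang.weaken_quantAny_all hc hφ⟩
  · rintro rfl
    exact BLang.weaken_base_bot B μ
  · exact BLang.weaken_base_of_ne_bot B hf hs
  · exact BLang.finite_iUnion_weaken (L := L) hc
      (fun φ h => (BLang.IsCanonical.of_mem_bigAnd (L := L) hc hφ h).1) μ
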